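/- Let $k$ be an algebraically closed field of characteristic $0$ and let $1<n<d$ be integers. Let $C_{n,d}$ be the monomial curve singularity with complete local ring $k+\langle t^d,t^{d+1},\dots,t^{d+n-1}\rangle+t^{2d}k[[t]]$. A curve on the equisingular stratum of $C_{n,d}$ is an irreducible curve singularity with complete local ring $\mathcal O\subset k[[t]]$ (a $k$-subalgebra containing $t^ck[[t]]$ for some $c$) having the same semigroup of values $\{\operatorname{ord}_t f: 0\ne f\in\mathcal O\}$ as $C_{n,d}$. A curve singularity $C$ deforms into a singularity of a given type if there are a flat family $\mathcal X\to\mathbb A^1$ of affine schemes of finite type over $k$ and a section $\sigma$ such that the complete local ring of $\mathcal X_0$ at $\sigma(0)$ is isomorphic to that of $C$ and, for all but finitely many $s\in k$, the fibre $\mathcal X_s$ has at $\sigma(s)$ a singularity of the given type (up to isomorphism of complete local $k$-algebras) and is smooth outside $\sigma(s)$. Points $p_1,\dots,p_r\in\mathbb P^{n-1}$ are in uniform position if they are distinct and, for every subset of $m$ of them and every $l\ge1$, the subset imposes $\min\{m,\binom{n+l-1}{l}\}$ conditions on forms of degree $l$. An $L_r^n$ is the singularity at the origin of the union of $r$ lines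 in $\mathbb A^n$ through the origin corresponding to $r$ points $p_i=[a_i]$, $a_i\in k^n$, in uniform position. For $N\ge n$, an $S_r^{n,N}$ is the singularity at the origin of a curve in $\mathbb A^N=\mathbb A^n\times\mathbb A^{N-n}$ which is the union of $r$ smooth branches $t\mapsto(t\,a_i,\,t^2b_i)$, where the $[a_i]$ are in uniform position, $b_i=0$ for $i\le\binom{n+1}{2}$, each $b_i$ with $i>\binom{n+1}2$ is one of the standard basis vectors of $k^{N-n}$, and each standard basis vector occurs among the $b_i$. **Proposition.** Let $C$ be a curve on the equisingular stratum of $C_{n,d}$. Then $C$ deforms into a curve singularity (not a smooth point) all of whose branches are smooth. More precisely, if $d\le 2n-1$, then $C$ deforms into an $L_d^n$; and if $d\ge 2n$, then $C$ deforms into an $S_d^{n,N}$ with $N=\max\{n,\,n+d-\binom{n+1}{2}\}$. -/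

import Mathlib

universe u

namespace CurveSing

open scoped Polynomial PowerSeries

/-! ### Irreducible curve germs as subrings of `k⟦X⟧` -/

/-- `O ⊆ k⟦t⟧` is the complete local ring of an irreducible (reduced) curve germ whose normalisation
is `k⟦t⟧`: it is a `k`-subalgebra containing a conductor ideal `t ^ c k⟦t⟧`. -/
def IsIrreducibleGerm {k : Type u} [Field k] (O : Subalgebra k k⟦X⟧) : Prop :=
  ∃ c : ℕ, ∀ f : k⟦X⟧, (PowerSeries.X : k⟦X⟧) ^ c ∣ f → f ∈ O

/-- The semigroup of values `{ord_t f : 0 ≠ f ∈ O}`. -/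
def valueSemigroup {k : Type u} [Field k] (O : Subalgebra k k⟦X⟧) : Set ℕ :=
  {m | ∃ f ∈ O, f.order = (m : ℕ∞)}

/-- The complete local ring of the monomial curve of the semigroup `S`: the power series all of whose
exponents lie in `S`. -/
def monomialGerm (k : Type u) [Field k] (S : AddSubmonoid ℕ) : Subalgebra k k⟦X⟧ where
  carrier := {f | ∀ m, PowerSeries.coeff m f ≠ 0 → m ∈ S}
  mul_mem' := by
    intro f g hf hg m hm
    rw [PowerSeries.coeff_mul] at hm
    obtain ⟨p, hp, hne⟩ := Finset.exists_ne_zero_of_sum_ne_zero hm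
    have hs : p.1 + p.2 = m := by simpa using hp
    rw [← hs]
    exact S.add_mem (hf _ (left_ne_zero_of_mul hne)) (hg _ (right_ne_zero_of_mul hne))
  add_mem' := by
    intro f g hf hg m hm
    by_cases h : PowerSeries.coeff m f = 0
    · exact hg m (by simpa [h] using hm)
    · exact hf m h
  algebraMap_mem' := by
    intro r m hm
    have h0 : m = 0 := by
      by_contra h
      apply hm
      rw [PowerSeries.algebraMap_apply, Algebra.algebraMap_self, RingHom.id_apply,
        PowerSeries.coeff_C, if_neg h]
    rw [h0]
    exact S.zero_mem

/-- The monomial curve `C_{n,d}`, with ring `k + ⟨t ^ d, …, t ^ (d + n - 1)⟩ + t ^ (2 d) k⟦t⟧`. -/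
def curveC (k : Type u) [Field k] (n d : ℕ) : Subalgebra k k⟦X⟧ :=
  monomialGerm k (AddSubmonoid.closure (Set.Ico d (d + n) ∪ Set.Ici (2 * d)))

/-- `O` lies on the equisingular stratum of `C_{n,d}`: it is an irreducible curve germ with the same
semigroup of values as `C_{n,d}`. -/
def IsEquisingularWithC {k : Type u} [Field k] (n d : ℕ) (O : Subalgebra k k⟦X⟧) : Prop :=
  IsIrreducibleGerm O ∧ valueSemigroup O = valueSemigroup (curveC k n d)

/-! ### One-parameter deformations -/

/-- A flat family of affine schemes of finite type over the affine line `Spec k[s]`, together with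
a section. -/
structure Family (k : Type u) [Field k] where
  /-- the coordinate ring of the total space -/
  total : Type u
  [commRing : CommRing total]
  [algebraBase : Algebra k total]
  [algebra : Algebra k[X] total]
  [isScalarTower : IsScalarTower k k[X] total]
  flat : Module.Flat k[X] total
  finiteType : Algebra.FiniteType k[X] total
  /-- the section -/
  sec : total →ₐ[k[X]] k[X]

attribute [instance] Family.commRing Family.algebraBase Family.algebra Family.isScalarTower

namespace Family

variable {k : Type u} [Field k] (F : Family k)

/-- The coordinate ring of the fibre over the point `s = c`. -/
abbrev fibre (c : k) : Type u :=
  F.total ⧸ Ideal.span {algebraMap k[X] F.total (Polynomial.X - Polynomial.C c)}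

/-- The point of the fibre over `s = c` that lies on the section, as an ideal of the fibre ring. -/
noncomputable def point (c : k) : Ideal (F.fibre c) :=
  (RingHom.ker ((Polynomial.evalRingHom c).comp F.sec.toRingHom)).map (Ideal.Quotient.mk _)

/-- The complete local ring of the fibre over `s = c` at the point of the section. -/
abbrev germ (c : k) : Type u :=
  AdicCompletion (F.point c) (F.fibre c)

/-- The fibre over `s = c` has no singularities outside the section. -/
def SmoothOffSection (c : k) : Prop :=
  ∀ (q : Ideal (F.fibre c)) [q.IsMaximal], q ≠ F.point c →
    IsRegularLocalRing (Localization.AtPrime q)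

end Family

/-- The curve singularity with complete local ring `O` deforms into a singularity with the property
`P` (a property of complete local `k`-algebras): there is a flat one-parameter family with a section
whose special fibre has, at the section, the given singularity, and whose general fibre has, at
the section, a singularity satisfying `P` and is smooth elsewhere. -/
def DeformsInto {k : Type u} [Field k] (O : Type u) [CommRing O] [Algebra k O]
    (P : (R : Type u) → [CommRing R] → [Algebra k R] → Prop) : Prop :=
  ∃ F : Family k, Nonempty (F.germ 0 ≃ₐ[k] O) ∧
    ∀ᶠ c : k in Filter.cofinite, P (F.germ c) ∧ F.SmoothOffSection c

/-! ### The target singularities -/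

/-- A curve singularity (that is, not a smooth point) with only smooth branches: the complete local
ring `R` is reduced and its quotient by each minimal prime is a power series ring `k⟦t⟧`. -/
def IsSingularWithSmoothBranches (k : Type u) [Field k] (R : Type u) [CommRing R] [Algebra k R] :
    Prop :=
  IsReduced R ∧ (∀ p ∈ minimalPrimes R, Nonempty ((R ⧸ p) ≃ₐ[k] k⟦X⟧)) ∧
    IsEmpty (R ≃ₐ[k] k⟦X⟧)

/-- The evaluation map from forms of degree `l` in `n` variables to the functions on the set of points
`a i`, `i ∈ T`. -/
noncomputable def formEval {k : Type u} [Field k] {n r : ℕ} (a : Fin r → Fin n → k)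
    (T : Finset (Fin r)) (l : ℕ) :
    MvPolynomial.homogeneousSubmodule (Fin n) k l →ₗ[k] (T → k) :=
  (LinearMap.pi fun i : T => (MvPolynomial.aeval (R := k) (a i)).toLinearMap) ∘ₗ
    (MvPolynomial.homogeneousSubmodule (Fin n) k l).subtype

/-- The vectors `a i` represent `r` distinct points of `ℙ ^ (n - 1)` in uniform position: every subset
imposes the maximal number of conditions on forms of degree `l`, for all `l ≥ 1`. -/
def IsUniformPosition {k : Type u} [Field k] {n r : ℕ} (a : Fin r → Fin n → k) : Prop :=
  (∀ i, a i ≠ 0) ∧ (∀ i j, i ≠ j → LinearIndependent k ![a i, a j]) ∧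
    ∀ (T : Finset (Fin r)) (l : ℕ), 1 ≤ l →
      Module.finrank k (LinearMap.range (formEval a T l)) =
        min T.card (Nat.choose (n + l - 1) l)

/-- The coordinate ring of the Zariski closure of a subset `Z` of affine space. -/
abbrev coordRing {k : Type u} [Field k] {σ : Type} (Z : Set (σ → k)) : Type u :=
  MvPolynomial σ k ⧸ MvPolynomial.vanishingIdeal k Z

/-- The complete local ring at the origin of the Zariski closure of `Z`. -/
abbrev germAtOrigin {k : Type u} [Field k] {σ : Type} (Z : Set (σ → k)) : Type u :=
  AdicCompletion
    ((Ideal.span (Set.range (MvPolynomial.X : σ → MvPolynomial σ k))).map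
      (Ideal.Quotient.mk (MvPolynomial.vanishingIdeal k Z)))
    (coordRing Z)

/-- The union of the lines through the origin spanned by the vectors `a i`. -/
def lines {k : Type u} [Field k] {n r : ℕ} (a : Fin r → Fin n → k) : Set (Fin n → k) :=
  {x | ∃ (i : Fin r) (t : k), x = t • a i}

/-- `R` is the complete local ring of an `L_r^n`: the singularity of `r` lines through the origin in
`𝔸 ^ n` in uniform position. -/
def IsL {k : Type u} [Field k] (r n : ℕ) (R : Type u) [CommRing R] [Algebra k R] : Prop :=
  ∃ a : Fin r → Fin n → k, IsUniformPosition a ∧ Nonempty (R ≃ₐ[k] germAtOrigin (lines a))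

/-- The union of the smooth branches `t ↦ (t a i, t ^ 2 b i)` in `𝔸 ^ n × 𝔸 ^ e`. -/
def parabolas {k : Type u} [Field k] {n e r : ℕ} (a : Fin r → Fin n → k) (b : Fin r → Fin e → k) :
    Set (Fin n ⊕ Fin e → k) :=
  {x | ∃ (i : Fin r) (t : k), x = Sum.elim (t • a i) (t ^ 2 • b i)}

/-- `R` is the complete local ring of an `S_r^{n,N}`: the singularity in `𝔸 ^ N ⊇ 𝔸 ^ n` with `r`
smooth branches, tangent to the lines `a i` of an `L_r^n`. The first `(n + 1).choose 2` branches are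
the lines themselves, every further one is a parabola `(t a i, t ^ 2 e_j)` in the direction of
one of the `N - n` new coordinates, and each new coordinate is used. -/
def IsS {k : Type u} [Field k] (r n N : ℕ) (R : Type u) [CommRing R] [Algebra k R] : Prop :=
  n ≤ N ∧ ∃ (a : Fin r → Fin n → k) (b : Fin r → Fin (N - n) → k),
    IsUniformPosition a ∧
    (∀ i : Fin r, i.val < (n + 1).choose 2 → b i = 0) ∧
    (∀ i : Fin r, (n + 1).choose 2 ≤ i.val → ∃ j, b i = Pi.single j 1) ∧
    (∀ j, ∃ i, b i = Pi.single j 1) ∧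
    Nonempty (R ≃ₐ[k] germAtOrigin (parabolas a b))

end CurveSing

namespace CurveSing

open scoped Polynomial PowerSeries

/-! The semigroup of `C_{n,d}` has no values in `[d + n, 2d)` and contains everything from `2d` on.
This forces `O = k + ⟨t^d p_1, …, t^d p_n⟩ + t^(2d) k⟦t⟧` for polynomials `p_j` independent modulo
`t^d` (`IsEquisingularWithC.exists_eq_gluedSubalgebra`). This form deforms by splitting the `d`-fold
root: replace `t^d` by `G = ∏ (t - i s)`, `i = 0, …, d - 1`, and `p_j` by `P_j = p_j + s q_j`, and
take the subalgebra `k[s] + ⟨G P_j⟩ + G^2 k[s][t]` of `k[s][t]`. It is torsion-free over `k[s]`,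
hence flat, and of finite type by the Artin–Tate lemma. Independence of the `p_j` modulo the
specialised `g` makes its fibre the corresponding subalgebra of `k[t]` (`exists_fibre_hom`).

At `s = 0` the completed fibre is `O`. For `s ≠ 0` the fibre is the affine line with `d` distinct
points `x_i` glued together, and it is regular elsewhere because `g^2 k[t]` lies in the ring. Only
first-order data survive modulo squares, so the germ is `branchAlgebra a` with `a i j = g'(x_i)
P_j(x_i)`: smooth branches with tangents `a i` and no condition from order two on
(`nonempty_adicCompletion_equiv_of_prod`).

Uniform position is a nonempty open condition on `a` (`exists_polynomial_isUniformPosition`).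
Lagrange interpolation chooses `q_j` so that it holds at `s = 1`; it then holds for all but finitely
many `s`.

Finally `branchAlgebra a` is identified with the targets. What has to be checked is that the
coordinate ring of the model contains `t^2` on each single branch. Quadrics provide this for up to
`(n + 1).choose 2` branches, and an extra coordinate for each further branch (`isL_of_equiv`,
`isS_of_equiv`). The same family therefore serves all three claims. -/

/-- The subalgebra `K + ⟨g p_1, …, g p_n⟩ + g ^ 2 S` of a `K`-algebra `S`. -/
def gluedSubalgebra (K : Type*) {S : Type*} [CommRing K] [CommRing S] [Algebra K S] {n : ℕ}
    (g : S) (p : Fin n → S) : Subalgebra K S where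
  carrier := {f | ∃ (α : K) (β : Fin n → K) (h : S),
    f = algebraMap K S α + g * ∑ j, β j • p j + g ^ 2 * h}
  mul_mem' := by
    rintro _ _ ⟨α, β, h, rfl⟩ ⟨α', β', h', rfl⟩
    refine ⟨α * α', fun j => α * β' j + α' * β j,
      (∑ j, β j • p j) * (∑ j, β' j • p j) + algebraMap K S α * h' + algebraMap K S α' * h +
      g * (∑ j, β j • p j) * h' + g * (∑ j, β' j • p j) * h + g ^ 2 * h * h', ?_⟩
    have : ∑ j, (α * β' j + α' * β j) • p j =
        algebraMap K S α * (∑ j, β' j • p j) + algebraMap K S α' * (∑ j, β j • p j) := by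
      simp only [← Algebra.smul_def, Finset.smul_sum, ← Finset.sum_add_distrib, add_smul, mul_smul]
    rw [this, map_mul]
    ring
  add_mem' := by
    rintro _ _ ⟨α, β, h, rfl⟩ ⟨α', β', h', rfl⟩
    refine ⟨α + α', fun j => β j + β' j, h + h', ?_⟩
    simp only [add_smul, Finset.sum_add_distrib, map_add]
    ring
  algebraMap_mem' r := ⟨r, 0, 0, by simp⟩

/-! ### Completions of glued rings. -/

section Completion

variable {k R S₀ S : Type*} [Field k] [CommRing R] [Algebra k R] [CommRing S₀] [Algebra k S₀]
  [CommRing S] [Algebra k S]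

/-- Since `u S₀` lies in the image of `I`, the factorisation `u^(m+1) h = (u · 1)^m (u · h)` takes
place inside `R`, with every factor in `I`. -/
theorem mem_pow_of_conductor {ψ : R →ₐ[k] S₀} (hψ : Function.Injective ψ) {I : Ideal R} {u : S₀}
    (hu : ∀ h, ∃ r ∈ I, ψ r = u * h) {m : ℕ} {r : R} (hr : u ^ m ∣ ψ r) : r ∈ I ^ m := by
  rcases m with _ | m
  · simp
  obtain ⟨h, hh⟩ := hr
  obtain ⟨r₁, h₁, e₁⟩ := hu 1
  obtain ⟨r₂, h₂, e₂⟩ := hu h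
  have : r = r₁ ^ m * r₂ := hψ (by rw [map_mul, map_pow, e₁, e₂, hh]; ring)
  rw [this, pow_succ]
  exact Ideal.mul_mem_mul (Ideal.pow_mem_pow h₁ m) h₂

/-- The conductor `g^2 S₀` lies in `I`, so the `I`-adic topology of `R` is the one induced from the
`ϖ`-adic topology of `S`. The completion is thus the closure of `R` in `S`. Because `θ` has dense
image and `θ g ^ 2` divides a power of `ϖ`, taking the closure only replaces `S₀` by `S` in the last
summand. -/
theorem nonempty_adicCompletion_equiv {n : ℕ} {g : S₀} {p : Fin n → S₀} {ψ : R →ₐ[k] S₀}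
    (hψ : Function.Injective ψ) (hrange : ψ.range = gluedSubalgebra k g p) {I : Ideal R}
    (hI₁ : ∀ r ∈ I, g ∣ ψ r) (hI₂ : ∀ r, g ^ 2 ∣ ψ r → r ∈ I) (θ : S₀ →ₐ[k] S) (ϖ : S)
    [IsAdicComplete (Ideal.span {ϖ}) S] (h₁ : ϖ ∣ θ g)
    (h₂ : ∀ m, ∃ N, ∀ f, ϖ ^ N ∣ θ f → g ^ m ∣ f)
    (h₃ : ∀ s m, ∃ f, ϖ ^ m ∣ θ f - s) (h₄ : ∃ c, θ g ^ 2 ∣ ϖ ^ c) :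
    Nonempty (AdicCompletion I R ≃ₐ[k] gluedSubalgebra k (θ g) (θ ∘ p)) := by
  set J : Ideal S := Ideal.span {ϖ} with hJ
  have memJ (m : ℕ) (s : S) : s ∈ J ^ m ↔ ϖ ^ m ∣ s := by
    rw [hJ, Ideal.span_singleton_pow, Ideal.mem_span_singleton]
  have hle (m : ℕ) : I ^ m ≤ (J ^ m).comap (θ.comp ψ) := by
    have : I ≤ J.comap (θ.comp ψ) := fun r hr => by
      rw [Ideal.mem_comap, ← pow_one J, memJ, pow_one]
      exact h₁.trans (map_dvd θ (hI₁ r hr))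
    exact (Ideal.pow_right_mono this m).trans (Ideal.le_comap_pow _ m)
  have hcond (m : ℕ) : ∃ N, ∀ r, ϖ ^ N ∣ θ (ψ r) → r ∈ I ^ m := by
    obtain ⟨N, hN⟩ := h₂ (2 * m)
    refine ⟨N, fun r hr => mem_pow_of_conductor hψ (u := g ^ 2) (fun h => ?_) ?_⟩
    · have : g ^ 2 * h ∈ ψ.range := by
        rw [hrange]; exact ⟨0, 0, h, by simp⟩
      obtain ⟨r, hr⟩ := this
      exact ⟨r, hI₂ r ⟨h, hr⟩, hr⟩
    · rw [← pow_mul]; exact hN _ hr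
  let f (m : ℕ) : AdicCompletion I R →ₐ[k] S ⧸ J ^ m :=
    (Ideal.quotientMapₐ (J ^ m) (θ.comp ψ) (hle m)).comp
      ((AdicCompletion.evalₐ I m).restrictScalars k)
  have hf {m : ℕ} {x : AdicCompletion I R} {r : R}
      (h : AdicCompletion.evalₐ I m x = Ideal.Quotient.mk _ r) :
      f m x = Ideal.Quotient.mk _ (θ (ψ r)) := by
    simp [f, h]
  have hcompat {m m' : ℕ} (hmm : m ≤ m') :
      (Ideal.Quotient.factorₐ k (Ideal.pow_le_pow_right hmm)).comp (f m') = f m := by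
    ext x
    obtain ⟨s, rfl⟩ := AdicCompletion.mk_surjective I R x
    have e : Ideal.Quotient.mk (I ^ m) (s.val m) = Ideal.Quotient.mk (I ^ m) (s.val m') :=
      (AdicCompletion.Ideal.mk_eq_mk I hmm s).symm
    rw [AlgHom.comp_apply, hf (AdicCompletion.evalₐ_mk I m' s),
      hf ((AdicCompletion.evalₐ_mk I m s).trans e)]
    simp
  let Φ : AdicCompletion I R →ₐ[k] S := IsAdicComplete.liftAlgHom J f hcompat
  have hΦ {m : ℕ} {x : AdicCompletion I R} {r : R}
      (h : AdicCompletion.evalₐ I m x = Ideal.Quotient.mk _ r) : ϖ ^ m ∣ Φ x - θ (ψ r) := by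
    rw [← memJ, ← Ideal.Quotient.eq, ← hf h]
    exact IsAdicComplete.mk_liftAlgHom J f hcompat m x
  have hinj : Function.Injective Φ := by
    rw [injective_iff_map_eq_zero]
    intro x hx
    refine AdicCompletion.ext_evalₐ fun m => ?_
    obtain ⟨N, hN⟩ := hcond m
    obtain ⟨s, rfl⟩ := AdicCompletion.mk_surjective I R x
    have h := hΦ (AdicCompletion.evalₐ_mk I (N + m) s)
    rw [hx, zero_sub, dvd_neg] at h
    have h' := hN _ ((pow_dvd_pow ϖ (Nat.le_add_right N m)).trans h)
    rw [AdicCompletion.evalₐ_mk, map_zero]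
    exact (AdicCompletion.Ideal.mk_eq_mk I (Nat.le_add_left m N) s).symm.trans
      (Ideal.Quotient.eq_zero_iff_mem.mpr h')
  have hrange' : Φ.range = gluedSubalgebra k (θ g) (θ ∘ p) := by
    apply le_antisymm
    · rintro _ ⟨x, rfl⟩
      -- Approximation modulo `ϖ^c` is approximation modulo `θ g ^ 2`, and that error is absorbed in
      -- the last summand.
      obtain ⟨c, hc⟩ := h₄
      obtain ⟨s, rfl⟩ := AdicCompletion.mk_surjective I R x
      obtain ⟨y, hy⟩ := hc.trans (hΦ (AdicCompletion.evalₐ_mk I c s))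
      have hm : ψ (s.val c) ∈ gluedSubalgebra k g p := hrange ▸ ⟨_, rfl⟩
      obtain ⟨α, β, h, e⟩ := hm
      rw [sub_eq_iff_eq_add, e] at hy
      refine ⟨α, β, y + θ h, hy.trans ?_⟩
      simp only [map_add, map_mul, map_sum, map_smul, map_pow, AlgHom.commutes, Function.comp]
      ring
    · rintro s ⟨α, β, h, rfl⟩
      set s := algebraMap k S α + θ g * ∑ j, β j • (θ ∘ p) j + θ g ^ 2 * h with hs
      have happ (m : ℕ) : ∃ r, ϖ ^ m ∣ θ (ψ r) - s := by
        obtain ⟨y, hy⟩ := h₃ h m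
        have : algebraMap k S₀ α + g * ∑ j, β j • p j + g ^ 2 * y ∈ ψ.range := by
          rw [hrange]; exact ⟨_, _, _, rfl⟩
        obtain ⟨r, hr⟩ := this
        refine ⟨r, ?_⟩
        have e : θ (ψ r) - s = θ g ^ 2 * (θ y - h) := by
          have hr' : ψ r = algebraMap k S₀ α + g * ∑ j, β j • p j + g ^ 2 * y := hr
          rw [hr', hs]
          simp only [map_add, map_mul, map_sum, map_smul, map_pow, AlgHom.commutes, Function.comp]
          ring
        rw [e]
        exact hy.mul_left _
      choose N hN using hcond
      choose r hr using happ
      -- The approximants are only close in `S`. Passing to the monotone sequence `N'`, which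
      -- dominates `N`, makes consecutive ones agree modulo `I^m`.
      let N' (m : ℕ) : ℕ := m + ∑ i ∈ Finset.range (m + 1), N i
      have hN' (m : ℕ) : N m ≤ N' m :=
        (Finset.single_le_sum (fun _ _ => Nat.zero_le _) (Finset.self_mem_range_succ m)).trans
          (Nat.le_add_left _ _)
      have hmono (m : ℕ) : N' m ≤ N' (m + 1) := by
        simp only [N', Finset.sum_range_succ _ (m + 1)]; omega
      let σ : AdicCompletion.AdicCauchySequence I R := AdicCompletion.AdicCauchySequence.mk I R
        (fun m => r (N' m)) fun m => by
          rw [SModEq.sub_mem, smul_eq_mul, Ideal.mul_top]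
          apply hN m
          have := dvd_sub ((pow_dvd_pow ϖ (hN' m)).trans (hr (N' m)))
            ((pow_dvd_pow ϖ ((hN' m).trans (hmono m))).trans (hr (N' (m + 1))))
          simpa using this
      refine ⟨AdicCompletion.mk I R σ, ?_⟩
      have hz (m : ℕ) : ϖ ^ m ∣ Φ (AdicCompletion.mk I R σ) - s := by
        have h1 := hΦ (AdicCompletion.evalₐ_mk I m σ)
        have h2 : ϖ ^ m ∣ θ (ψ (σ.val m)) - s :=
          (pow_dvd_pow ϖ (Nat.le_add_right m _)).trans (hr (N' m))
        simpa using dvd_add h1 h2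
      have := IsHausdorff.haus (I := J) (M := S) inferInstance
        (Φ (AdicCompletion.mk I R σ) - s) fun m => by
          rw [SModEq.zero, smul_eq_mul, Ideal.mul_top, memJ]; exact hz m
      exact sub_eq_zero.mp this
  exact ⟨(AlgEquiv.ofInjective Φ hinj).trans (Subalgebra.equivOfEq _ _ hrange')⟩

end Completion

/-! ### Normal form of curves on the equisingular stratum. -/

section Equisingular

variable {k : Type*} [Field k]

theorem mem_closure_iff {n d m : ℕ} (hd : n < d) :
    m ∈ AddSubmonoid.closure (Set.Ico d (d + n) ∪ Set.Ici (2 * d)) ↔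
      m = 0 ∨ (d ≤ m ∧ m < d + n) ∨ 2 * d ≤ m := by
  constructor
  · intro h
    induction h using AddSubmonoid.closure_induction with
    | mem x hx => exact Or.inr hx
    | zero => exact Or.inl rfl
    | add x y _ _ hx hy => omega
  · rintro (rfl | h | h)
    · exact zero_mem _
    · exact AddSubmonoid.subset_closure (Or.inl h)
    · exact AddSubmonoid.subset_closure (Or.inr h)

theorem mem_valueSemigroup_monomialGerm {S : AddSubmonoid ℕ} {m : ℕ} :
    m ∈ valueSemigroup (monomialGerm k S) ↔ m ∈ S := by
  constructor
  · rintro ⟨f, hf, hm⟩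
    exact hf m (PowerSeries.order_eq_nat.mp hm).1
  · intro h
    refine ⟨PowerSeries.X ^ m, fun i hi => ?_, PowerSeries.order_X_pow m⟩
    rw [PowerSeries.coeff_X_pow] at hi
    have : i = m := by by_contra hne; simp [hne] at hi
    exact this ▸ h

/-- Cancelling the leading term of `f` with a multiple of `g`. -/
theorem exists_X_pow_succ_dvd_sub_smul {f g : k⟦X⟧} {m : ℕ} (hf : PowerSeries.X ^ m ∣ f)
    (hg : g.order = (m : ℕ∞)) : ∃ c : k, PowerSeries.X ^ (m + 1) ∣ f - c • g := by
  obtain ⟨hg0, hg1⟩ := PowerSeries.order_eq_nat.mp hg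
  refine ⟨PowerSeries.coeff m f / PowerSeries.coeff m g, ?_⟩
  rw [PowerSeries.X_pow_dvd_iff] at hf ⊢
  intro i hi
  rcases Nat.lt_succ_iff_lt_or_eq.mp hi with h | rfl
  · simp [hf i h, hg1 i h]
  · simp [div_mul_cancel₀ _ hg0]

/-- Leading terms are cancelled by elements of `O` until the order reaches the conductor exponent
`c`; `e` bounds the number of cancellations left. -/
theorem mem_of_X_pow_dvd {O : Subalgebra k k⟦X⟧} (hO : IsIrreducibleGerm O) {N : ℕ}
    (hN : ∀ m, N ≤ m → m ∈ valueSemigroup O) {f : k⟦X⟧} (hf : PowerSeries.X ^ N ∣ f) : f ∈ O := by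
  obtain ⟨c, hc⟩ := hO
  suffices ∀ e m : ℕ, N ≤ m → c ≤ m + e → ∀ f, PowerSeries.X ^ m ∣ f → f ∈ O from
    this c N le_rfl (Nat.le_add_left _ _) f hf
  intro e
  induction e with
  | zero => exact fun m _ h f hf => hc f ((pow_dvd_pow _ h).trans hf)
  | succ e ih =>
    intro m hm h f hf
    obtain ⟨g, hg, ho⟩ := hN m hm
    obtain ⟨a, ha⟩ := exists_X_pow_succ_dvd_sub_smul hf ho
    have := ih (m + 1) (by omega) (by omega) _ ha
    simpa using O.add_mem this (O.smul_mem hg a)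

/-- Every curve on the equisingular stratum of `C_{n,d}` is `k + ⟨t ^ d p_j⟩ + t ^ (2 d) k⟦t⟧` with
polynomials `p_j` that are linearly independent modulo `t ^ d`. -/
theorem IsEquisingularWithC.exists_eq_gluedSubalgebra {n d : ℕ} (hd : n < d)
    {O : Subalgebra k k⟦X⟧} (hO : IsEquisingularWithC n d O) :
    ∃ p : Fin n → k[X], O = gluedSubalgebra k (PowerSeries.X ^ d : k⟦X⟧) (fun j => (p j : k⟦X⟧)) ∧
      ∀ β : Fin n → k, Polynomial.X ^ d ∣ ∑ j, β j • p j → β = 0 := by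
  obtain ⟨hO, hv⟩ := hO
  have hval (m : ℕ) : m ∈ valueSemigroup O ↔ m = 0 ∨ (d ≤ m ∧ m < d + n) ∨ 2 * d ≤ m := by
    rw [hv, curveC, mem_valueSemigroup_monomialGerm, mem_closure_iff hd]
  have hcond : ∀ f : k⟦X⟧, PowerSeries.X ^ (2 * d) ∣ f → f ∈ O := fun f hf =>
    mem_of_X_pow_dvd hO (fun m hm => (hval m).mpr (Or.inr (Or.inr hm))) hf
  have hgen (j : Fin n) : ∃ u : k⟦X⟧, PowerSeries.X ^ d * u ∈ O ∧ u.order = (j : ℕ) := by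
    obtain ⟨f, hf, ho⟩ := (hval (d + j)).mpr (by omega)
    obtain ⟨u, rfl⟩ : PowerSeries.X ^ d ∣ f := PowerSeries.X_pow_dvd_iff.mpr fun i hi =>
      (PowerSeries.order_eq_nat.mp ho).2 i (by omega)
    refine ⟨u, hf, ?_⟩
    rw [PowerSeries.order_mul, PowerSeries.order_X_pow] at ho
    push_cast at ho
    exact WithTop.add_left_cancel (ENat.natCast_ne_top d) ho
  choose u hu huo using hgen
  have hpu (j : Fin n) : PowerSeries.X ^ d ∣ u j - (PowerSeries.trunc d (u j) : k⟦X⟧) := by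
    rw [PowerSeries.X_pow_dvd_iff]
    intro i hi
    rw [map_sub, Polynomial.coeff_coe, PowerSeries.coeff_trunc, if_pos hi, sub_self]
  choose v hv using hpu
  have hXp (j : Fin n) : PowerSeries.X ^ d * (PowerSeries.trunc d (u j) : k⟦X⟧) ∈ O := by
    have : PowerSeries.X ^ d * (PowerSeries.trunc d (u j) : k⟦X⟧) =
        PowerSeries.X ^ d * u j - PowerSeries.X ^ (2 * d) * v j := by
      rw [← sub_eq_zero, two_mul, pow_add, mul_assoc, ← hv]; ring
    rw [this]
    exact O.sub_mem (hu j) (hcond _ ⟨_, rfl⟩)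
  -- Here `e` counts the values `d + (n - e), …, d + n - 1` still to be cancelled. At `e = 0` the
  -- gap `[d + n, 2d)` of the semigroup lifts the order to at least `2d`.
  have hred (e : ℕ) : ∀ f ∈ O, e ≤ n → PowerSeries.X ^ (d + (n - e)) ∣ f →
      ∃ β : Fin n → k, PowerSeries.X ^ (2 * d) ∣ f - PowerSeries.X ^ d * ∑ j, β j • u j := by
    induction e with
    | zero =>
      intro f hf _ hdvd
      refine ⟨0, ?_⟩
      simp only [Pi.zero_apply, zero_smul, Finset.sum_const_zero, mul_zero, sub_zero]
      by_cases h0 : f = 0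
      · simp [h0]
      obtain ⟨m, hm⟩ := ENat.ne_top_iff_exists.mp (PowerSeries.order_eq_top.not.mpr h0)
      have h1 := (hval m).mp ⟨f, hf, hm.symm⟩
      have h2 : d + n ≤ m := by
        by_contra hlt
        exact (PowerSeries.order_eq_nat.mp hm.symm).1
          (PowerSeries.X_pow_dvd_iff.mp hdvd m (by omega))
      exact PowerSeries.X_pow_dvd_iff.mpr fun i hi =>
        (PowerSeries.order_eq_nat.mp hm.symm).2 i (by omega)
    | succ e ih =>
      intro f hf he hdvd
      have hj : n - (e + 1) < n := by omega
      obtain ⟨c, hc⟩ := exists_X_pow_succ_dvd_sub_smul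
        (g := PowerSeries.X ^ d * u ⟨n - (e + 1), hj⟩) hdvd
        (by rw [PowerSeries.order_mul, PowerSeries.order_X_pow, huo]; push_cast; rfl)
      obtain ⟨β, hβ⟩ := ih _ (O.sub_mem hf (O.smul_mem (hu _) c)) (by omega)
        (by convert hc using 2; omega)
      refine ⟨β + Pi.single ⟨n - (e + 1), hj⟩ c, ?_⟩
      convert hβ using 1
      simp only [Pi.add_apply, add_smul, Finset.sum_add_distrib, Pi.single_apply, ite_smul,
        zero_smul, Finset.sum_ite_eq', Finset.mem_univ, if_true, mul_add, mul_smul_comm]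
      abel
  refine ⟨fun j => PowerSeries.trunc d (u j), ?_, ?_⟩
  · apply le_antisymm
    · intro f hf
      set f₀ := f - algebraMap k k⟦X⟧ (PowerSeries.constantCoeff f) with hf₀
      have hf₀O : f₀ ∈ O := O.sub_mem hf (O.algebraMap_mem _)
      have hdvd : PowerSeries.X ^ (d + (n - n)) ∣ f₀ := by
        by_cases h0 : f₀ = 0
        · simp [h0]
        obtain ⟨m, hm⟩ := ENat.ne_top_iff_exists.mp (PowerSeries.order_eq_top.not.mpr h0)
        have h1 := (hval m).mp ⟨f₀, hf₀O, hm.symm⟩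
        have h2 : m ≠ 0 := by
          rintro rfl
          apply (PowerSeries.order_eq_nat.mp hm.symm).1
          simp [hf₀]
        exact PowerSeries.X_pow_dvd_iff.mpr fun i hi =>
          (PowerSeries.order_eq_nat.mp hm.symm).2 i (by omega)
      obtain ⟨β, h, hβ⟩ := hred n f₀ hf₀O le_rfl hdvd
      refine ⟨PowerSeries.constantCoeff f, β, h + ∑ j, β j • v j, ?_⟩
      have e : ∑ j, β j • u j = ∑ j, β j • (PowerSeries.trunc d (u j) : k⟦X⟧) +
          PowerSeries.X ^ d * ∑ j, β j • v j := by
        rw [Finset.mul_sum, ← Finset.sum_add_distrib]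
        refine Finset.sum_congr rfl fun j _ => ?_
        rw [mul_smul_comm, ← hv, ← smul_add]; congr 1; ring
      rw [e, hf₀] at hβ
      rw [← sub_eq_zero] at hβ ⊢
      rw [← hβ]; ring
    · rintro _ ⟨α, β, h, rfl⟩
      refine O.add_mem (O.add_mem (O.algebraMap_mem _) ?_) (hcond _ ⟨h, by ring⟩)
      rw [Finset.mul_sum]
      exact O.sum_mem fun j _ => by rw [mul_smul_comm]; exact O.smul_mem (hXp j) _
  · intro β hβ
    by_contra hne
    have hex : ∃ m : ℕ, ∃ h : m < n, β ⟨m, h⟩ ≠ 0 := by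
      by_contra hall
      push Not at hall
      exact hne (funext fun j => hall j j.2)
    classical
    -- The orders of the `u j` are distinct, so the coefficient at the least index `m` with `β m ≠
    -- 0` cannot cancel.
    obtain ⟨hm, hm0⟩ := Nat.find_spec hex
    set m := Nat.find hex
    rw [Polynomial.X_pow_dvd_iff] at hβ
    have := hβ m (by omega)
    rw [Polynomial.finsetSum_coeff, Finset.sum_eq_single ⟨m, hm⟩] at this
    · rw [Polynomial.coeff_smul, PowerSeries.coeff_trunc, if_pos (by omega), smul_eq_mul] at this
      exact (PowerSeries.order_eq_nat.mp (huo ⟨m, hm⟩)).1 ((mul_eq_zero.mp this).resolve_left hm0)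
    · intro j _ hj
      rw [Polynomial.coeff_smul, PowerSeries.coeff_trunc, if_pos (by omega), smul_eq_mul]
      rcases lt_trichotomy j.1 m with h | h | h
      · have := Nat.find_min hex h
        push Not at this
        rw [this j.2, zero_mul]
      · exact absurd (Fin.ext h) hj
      · rw [(PowerSeries.order_eq_nat.mp (huo j)).2 m h, mul_zero]
    · simp

end Equisingular

/-! ### Uniform position as a generic condition. -/

section UniformPosition

variable {k : Type*} [Field k] {n r : ℕ}

theorem finrank_range_formEval_le (a : Fin r → Fin n → k) (T : Finset (Fin r)) (l : ℕ) :
    Module.finrank k (LinearMap.range (formEval a T l)) ≤ min T.card (Nat.choose (n + l - 1) l) := by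
  classical
  refine le_min ((Submodule.finrank_le _).trans (by simp)) ?_
  have h : LinearMap.range (formEval a T l) = Submodule.span k
      (((Finset.univ.finsuppAntidiag l).image fun α : Fin n →₀ ℕ =>
        fun i : T => MvPolynomial.aeval (a i) (MvPolynomial.monomial α (1 : k)) :
          Finset (T → k)) : Set (T → k)) := by
    rw [formEval, LinearMap.range_comp, Submodule.range_subtype,
      MvPolynomial.homogeneousSubmodule_eq_finsupp_supported,
      AddMonoidAlgebra.supported_eq_span_single, Submodule.map_span, Finset.coe_image,
      Set.image_image]
    congr 1
    ext v
    simp only [Set.mem_image, Set.mem_ofPred_eq, Finset.mem_coe, Finset.mem_finsuppAntidiag,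
      Finset.subset_univ, and_true, Finsupp.degree_eq_sum]
    rfl
  rw [h]
  refine (finrank_span_finset_le_card _).trans (Finset.card_image_le.trans ?_)
  rw [Finset.card_finsuppAntidiag_nat_eq_choose]
  simp

theorem card_le_finrank_range_formEval {a : Fin r → Fin n → k} {T : Finset (Fin r)} {l m : ℕ}
    {e : Fin m → Fin r} (he : ∀ i, e i ∈ T) {α : Fin m → Fin n →₀ ℕ}
    (hα : ∀ i, (α i).degree = l)
    (hdet : (Matrix.of fun i j => ∏ c, a (e i) c ^ α j c).det ≠ 0) :
    m ≤ Module.finrank k (LinearMap.range (formEval a T l)) := by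
  let w (j : Fin m) : LinearMap.range (formEval a T l) :=
    ⟨formEval a T l ⟨MvPolynomial.monomial (α j) 1,
      MvPolynomial.isHomogeneous_monomial 1 (hα j)⟩, _, rfl⟩
  have hw : LinearIndependent k w := by
    rw [Fintype.linearIndependent_iff]
    intro c hc
    refine congrFun (Matrix.eq_zero_of_mulVec_eq_zero hdet (v := c) (funext fun i => ?_))
    have h : ∑ j, c j * MvPolynomial.aeval (a (e i)) (MvPolynomial.monomial (α j) (1 : k)) = 0 := by
      have := congrFun (congrArg Subtype.val hc) ⟨e i, he i⟩
      rw [AddSubmonoidClass.coe_finsetSum, Finset.sum_apply] at this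
      exact this
    rw [Matrix.mulVec, dotProduct, Pi.zero_apply, ← h]
    refine Finset.sum_congr rfl fun j _ => ?_
    rw [MvPolynomial.aeval_monomial, map_one, one_mul, mul_comm, Matrix.of_apply,
      Finsupp.prod_fintype _ _ (fun _ => pow_zero _)]
  simpa using hw.fintype_card_le_finrank

theorem formEval_surjective_of_le {a : Fin r → Fin n → k} {T : Finset (Fin r)} {l : ℕ}
    (h : T.card ≤ Module.finrank k (LinearMap.range (formEval a T l))) :
    Function.Surjective (formEval a T l) := by
  rw [← LinearMap.range_eq_top]
  exact Submodule.eq_top_of_finrank_eq (le_antisymm (Submodule.finrank_le _) (by simpa using h))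

/-- Minors of the generic evaluation matrix of monomials do not vanish. -/
theorem det_generic_monomials_ne_zero {m : ℕ} {e : Fin m → Fin r} (he : Function.Injective e)
    {α : Fin m → Fin n →₀ ℕ} (hα : Function.Injective α) :
    (Matrix.of fun i j => ∏ c, (MvPolynomial.X (e i, c) : MvPolynomial (Fin r × Fin n) k) ^ α j c).det
      ≠ 0 := by
  classical
  -- Different rows use disjoint sets of variables. The monomial of a permutation in the determinant
  -- expansion therefore determines the permutation, and the identity term survives with coefficient
  -- one.
  let β (i j : Fin m) : Fin r × Fin n →₀ ℕ := (α j).mapDomain (Prod.mk (e i))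
  have hβ (i j : Fin m) : ∏ c, (MvPolynomial.X (e i, c) : MvPolynomial (Fin r × Fin n) k) ^ α j c =
      MvPolynomial.monomial (β i j) 1 := by
    rw [MvPolynomial.monomial_eq, map_one, one_mul, Finsupp.prod_mapDomain_index_inj
      (Prod.mk_right_injective _), Finsupp.prod_fintype _ _ (fun _ => pow_zero _)]
  have hval (σ : Equiv.Perm (Fin m)) (j : Fin m) (c : Fin n) :
      (∑ i, β (σ i) i) (e j, c) = α (σ⁻¹ j) c := by
    rw [Finsupp.finsetSum_apply, Finset.sum_eq_single (σ⁻¹ j)]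
    · have hj : σ (σ⁻¹ j) = j := by simp
      simp only [β, hj]
      exact Finsupp.mapDomain_apply (Prod.mk_right_injective _) _ _
    · intro i _ hi
      refine Finsupp.mapDomain_of_notMem_range _ _ ?_
      rintro ⟨c', hc'⟩
      exact hi (by rw [← he (Prod.ext_iff.mp hc').1]; simp)
    · simp
  intro h0
  have h1 := congrArg (MvPolynomial.coeff (∑ i, β i i)) h0
  rw [Matrix.det_apply, MvPolynomial.coeff_sum, Finset.sum_eq_single 1] at h1
  · simp [hβ, ← MvPolynomial.monomial_sum_one] at h1
  · intro σ _ hσ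
    simp only [Matrix.of_apply, hβ, ← MvPolynomial.monomial_sum_one]
    rw [MvPolynomial.coeff_smul, MvPolynomial.coeff_monomial, if_neg, smul_zero]
    intro heq
    apply hσ
    rw [← inv_inj, inv_one]
    ext j : 1
    refine hα (Finsupp.ext fun c => ?_)
    have := DFunLike.congr_fun heq (e j, c)
    have h' := hval 1 j c
    simp only [Equiv.Perm.coe_one, id_eq, inv_one] at h'
    rw [hval, h'] at this
    exact this
  · simp

/-- The rank conditions in degree at most `r` imply uniform position. -/
theorem isUniformPosition_of_le {a : Fin r → Fin n → k} (hn : 1 < n)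
    (h : ∀ (T : Finset (Fin r)) (l : ℕ), l ≤ r → min T.card (Nat.choose (n + l - 1) l) ≤
      Module.finrank k (LinearMap.range (formEval a T l))) : IsUniformPosition a := by
  classical
  have hlin (f : MvPolynomial.homogeneousSubmodule (Fin n) k 1) :
      ∃ c : Fin n → k, ∀ x : Fin n → k, MvPolynomial.aeval x f.1 = ∑ j, c j * x j := by
    obtain ⟨f, hf⟩ := f
    rw [MvPolynomial.homogeneousSubmodule_one_eq_span_X] at hf
    obtain ⟨c, hc⟩ := Submodule.mem_span_range_iff_exists_fun k |>.mp hf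
    exact ⟨c, fun x => by simp [← hc, Algebra.smul_def]⟩
  -- As `n ≥ 2`, linear forms take arbitrary values on at most two points; this yields both
  -- nonvanishing and pairwise independence.
  have hone (T : Finset (Fin r)) (hT : T.card ≤ 2) (hr : 1 ≤ r) :
      Function.Surjective (formEval a T 1) := by
    refine formEval_surjective_of_le ((le_min le_rfl ?_).trans (h T 1 hr))
    simp only [Nat.add_sub_cancel, Nat.choose_one_right]
    omega
  have hne (i : Fin r) : a i ≠ 0 := by
    intro h0
    obtain ⟨f, hf⟩ := hone {i} (by simp) (by have := i.2; omega) 1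
    obtain ⟨c, hc⟩ := hlin f
    have : MvPolynomial.aeval (a i) f.1 = 1 := congrFun hf ⟨i, by simp⟩
    rw [hc, h0] at this
    simp at this
  refine ⟨hne, fun i j hij => ?_, fun T l hl => ?_⟩
  · rw [LinearIndependent.pair_iff]
    intro s t hst
    have key (u : ({i, j} : Finset (Fin r)) → k) :
        s * u ⟨i, by simp⟩ + t * u ⟨j, by simp⟩ = 0 := by
      obtain ⟨f, rfl⟩ := hone {i, j} Finset.card_le_two (by have := i.2; omega) u
      obtain ⟨c, hc⟩ := hlin f
      change s * MvPolynomial.aeval (a i) f.1 + t * MvPolynomial.aeval (a j) f.1 = 0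
      rw [hc, hc, Finset.mul_sum, Finset.mul_sum, ← Finset.sum_add_distrib]
      refine Finset.sum_eq_zero fun x _ => ?_
      have := congrFun hst x
      simp only [Pi.add_apply, Pi.smul_apply, smul_eq_mul, Pi.zero_apply] at this
      linear_combination c x * this
    have h1 := key (Pi.single ⟨i, by simp⟩ 1)
    have h2 := key (Pi.single ⟨j, by simp⟩ 1)
    rw [Pi.single_eq_same, Pi.single_eq_of_ne (by simpa using hij.symm)] at h1
    rw [Pi.single_eq_same, Pi.single_eq_of_ne (by simpa using hij)] at h2
    exact ⟨by simpa using h1, by simpa using h2⟩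
  · rcases le_or_gt l r with hlr | hlr
    · exact le_antisymm (finrank_range_formEval_le a T l) (h T l hlr)
    -- From degree `r` on there are at least `r + 1` monomials, so the rank condition means
    -- surjectivity. It propagates to higher degrees on multiplying by a coordinate that does not
    -- vanish at the chosen point.
    have hch (m : ℕ) (hm : r ≤ m) : T.card ≤ Nat.choose (n + m - 1) m := by
      have h1 : T.card ≤ r := by simpa using Finset.card_le_univ T
      have h2 : Nat.choose (m + 1) m ≤ Nat.choose (n + m - 1) m := Nat.choose_le_choose _ (by omega)
      rw [Nat.choose_succ_self_right] at h2
      omega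
    have hsurj (m : ℕ) (hm : r ≤ m) : Function.Surjective (formEval a T m) := by
      induction m, hm using Nat.le_induction with
      | base => exact formEval_surjective_of_le ((le_min le_rfl (hch r le_rfl)).trans (h T r le_rfl))
      | succ m hm ih =>
        intro u
        choose f hf using ih
        have hc (i : T) : ∃ c, a i c ≠ 0 := Function.ne_iff.mp (hne i)
        choose c hc using hc
        refine ⟨∑ i : T, ⟨MvPolynomial.X (c i) *
          (f (Pi.single i (u i * (a i (c i))⁻¹))).1, ?_⟩, ?_⟩
        · rw [MvPolynomial.mem_homogeneousSubmodule, add_comm]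
          exact (MvPolynomial.isHomogeneous_X k (c i)).mul (f _).2
        · rw [map_sum]
          ext i
          rw [Finset.sum_apply, Finset.sum_eq_single i]
          · have := congrFun (hf (Pi.single i (u i * (a i (c i))⁻¹))) i
            change MvPolynomial.aeval (a i) (f _).1 = _ at this
            change MvPolynomial.aeval (a i) (_ * (f _).1) = _
            rw [map_mul, this, MvPolynomial.aeval_X, Pi.single_eq_same, mul_comm,
              inv_mul_cancel_right₀ (hc i)]
          · intro j _ hji
            have := congrFun (hf (Pi.single j (u j * (a j (c j))⁻¹))) i
            change MvPolynomial.aeval (a i) (f _).1 = _ at this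
            change MvPolynomial.aeval (a i) (_ * (f _).1) = _
            rw [map_mul, this, Pi.single_eq_of_ne (Ne.symm hji), mul_zero]
          · simp
    rw [min_eq_left (hch l hlr.le), LinearMap.range_eq_top.mpr (hsurj l hlr.le), finrank_top]
    simp

/-- Generic points are in uniform position. -/
theorem exists_polynomial_isUniformPosition (k : Type*) [Field k] {n : ℕ} (r : ℕ) (hn : 1 < n) :
    ∃ P : MvPolynomial (Fin r × Fin n) k, P ≠ 0 ∧ ∀ a : Fin r → Fin n → k,
      MvPolynomial.eval (fun x => a x.1 x.2) P ≠ 0 → IsUniformPosition a := by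
  classical
  have hD (T : Finset (Fin r)) (l : ℕ) : ∃ D : MvPolynomial (Fin r × Fin n) k, D ≠ 0 ∧
      ∀ a : Fin r → Fin n → k, MvPolynomial.eval (fun x => a x.1 x.2) D ≠ 0 →
        min T.card (Nat.choose (n + l - 1) l) ≤
          Module.finrank k (LinearMap.range (formEval a T l)) := by
    set m := min T.card (Nat.choose (n + l - 1) l) with hm
    have hcard : m ≤ Fintype.card ((Finset.univ : Finset (Fin n)).finsuppAntidiag l) := by
      rw [Fintype.card_coe, Finset.card_finsuppAntidiag_nat_eq_choose, Finset.card_univ,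
        Fintype.card_fin]
      exact min_le_right _ _
    obtain ⟨e⟩ := Function.Embedding.nonempty_of_card_le (α := Fin m) (β := T)
      (by rw [Fintype.card_coe, Fintype.card_fin]; exact min_le_left _ _)
    obtain ⟨α⟩ := Function.Embedding.nonempty_of_card_le (α := Fin m)
      (β := (Finset.univ : Finset (Fin n)).finsuppAntidiag l) (by rwa [Fintype.card_fin])
    refine ⟨_, det_generic_monomials_ne_zero (e := fun i => (e i).1) (α := fun i => (α i).1)
      (Subtype.val_injective.comp e.injective) (Subtype.val_injective.comp α.injective),
      fun a ha => card_le_finrank_range_formEval (e := fun i => (e i).1)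
        (fun i => (e i).2) (α := fun i => (α i).1) (fun i => ?_) ?_⟩
    · have := (Finset.mem_finsuppAntidiag.mp (α i).2).1
      rw [Finsupp.degree_eq_sum]
      exact this
    · convert ha
      rw [RingHom.map_det]
      congr 1
      ext i j
      simp
  choose D hD₀ hD₁ using hD
  -- One generic minor for each subset and each degree up to `r`; `isUniformPosition_of_le` makes
  -- this finite product sufficient.
  refine ⟨∏ T : Finset (Fin r), ∏ l ∈ Finset.range (r + 1), D T l, ?_, fun a ha => ?_⟩
  · simp only [Finset.prod_ne_zero_iff]
    exact fun T _ l _ => hD₀ T l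
  · simp only [map_prod, Finset.prod_ne_zero_iff, Finset.mem_univ, true_implies,
      Finset.mem_range] at ha
    exact isUniformPosition_of_le hn fun T l hl => hD₁ T l a (ha T l (by omega))

end UniformPosition

/-! ### Regularity away from the conductor. -/

section Regular

/-- If `R ⊆ P` with `P` a principal ideal domain and `u P ⊆ R`, then `R` is regular at all primes
not containing `u`. -/
theorem isRegularLocalRing_of_notMem_conductor {R P : Type*} [CommRing R] [CommRing P] [IsDomain P]
    [IsPrincipalIdealRing P] {ψ : R →+* P} (hψ : Function.Injective ψ) (q : Ideal R) [q.IsPrime]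
    {u : R} (huq : u ∉ q) (hu : ∀ h, ∃ r, ψ r = ψ u * h) :
    IsRegularLocalRing (Localization.AtPrime q) := by
  have : IsDomain R := hψ.isDomain ψ
  have : IsDomain (Localization.AtPrime q) :=
    IsLocalization.isDomain_localization q.primeCompl_le_nonZeroDivisors
  choose r hr using hu
  let v : q.primeCompl := ⟨u, huq⟩
  let A := Localization.AtPrime q
  have hspec (h : P) (y : R) (hy : ψ y = h) : IsLocalization.mk' A (r h) v = algebraMap R A y := by
    rw [IsLocalization.mk'_eq_iff_eq_mul, ← map_mul]
    congr 1
    apply hψ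
    rw [hr, map_mul, hy, mul_comm]
  -- The map `h ↦ (u h) / u` embeds `P` into the localization, where `u` is a unit. Every ideal of
  -- `A` is then generated by the image of a generator of its preimage in `P`, so `A` is a principal
  -- ideal domain.
  let φ : P →+* A :=
    { toFun := fun h => IsLocalization.mk' A (r h) v
      map_one' := by rw [hspec 1 1 (map_one ψ), map_one]
      map_mul' := fun x y => by
        rw [← IsLocalization.mk'_mul, IsLocalization.mk'_eq_iff_eq]
        congr 1
        apply hψ
        simp only [map_mul, hr, Submonoid.coe_mul, v]
        ring
      map_zero' := by rw [hspec 0 0 (map_zero ψ), map_zero]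
      map_add' := fun x y => by
        rw [← IsLocalization.mk'_add, IsLocalization.mk'_eq_iff_eq]
        congr 1
        apply hψ
        simp only [map_mul, map_add, hr, Submonoid.coe_mul, v]
        ring }
  have hφ (y : R) : φ (ψ y) = algebraMap R A y := hspec _ y rfl
  have : IsPrincipalIdealRing A := ⟨fun J => by
    obtain ⟨x₀, hx₀⟩ := IsPrincipalIdealRing.principal (J.comap φ)
    refine ⟨φ x₀, le_antisymm (fun z hz => ?_) ?_⟩
    · obtain ⟨y, s, rfl⟩ := IsLocalization.exists_mk'_eq q.primeCompl z
      have hy : ψ y ∈ J.comap φ := by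
        rw [Ideal.mem_comap, hφ, ← IsLocalization.mk'_spec A y s]
        exact J.mul_mem_right _ hz
      rw [hx₀] at hy
      obtain ⟨c, hc⟩ := Ideal.mem_span_singleton.mp hy
      refine Ideal.mem_span_singleton.mpr ?_
      have h1 : φ x₀ ∣ algebraMap R A y := ⟨φ c, by rw [← hφ, hc, map_mul]⟩
      rw [IsLocalization.mk'_eq_mul_mk'_one]
      exact h1.mul_right _
    · refine (Ideal.span_singleton_le_iff_mem _).mpr ?_
      have : x₀ ∈ J.comap φ := hx₀ ▸ Ideal.mem_span_singleton_self x₀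
      exact this⟩
  infer_instance

end Regular

/-! ### Adic completeness of products of power series rings. -/

section PiPowerSeries

variable {ι R : Type*} [CommRing R]

theorem pi_pow_dvd_iff {M : ι → Type*} [∀ i, CommMonoid (M i)] {x y : ∀ i, M i} {m : ℕ} :
    x ^ m ∣ y ↔ ∀ i, x i ^ m ∣ y i := pi_dvd_iff

instance isAdicComplete_pi_powerSeries :
    IsAdicComplete (Ideal.span {fun _ : ι => (PowerSeries.X : R⟦X⟧)}) (ι → R⟦X⟧) where
  haus' f hf := by
    ext i m
    have := hf (m + 1)
    rw [SModEq.zero, smul_eq_mul, Ideal.mul_top, Ideal.span_singleton_pow,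
      Ideal.mem_span_singleton, pi_pow_dvd_iff] at this
    exact PowerSeries.X_pow_dvd_iff.mp (this i) m m.lt_succ_self
  prec' f hf := by
    have hdvd {m l : ℕ} (hml : m ≤ l) (i : ι) : PowerSeries.X ^ m ∣ f m i - f l i := by
      have := hf hml
      rw [SModEq.sub_mem, smul_eq_mul, Ideal.mul_top, Ideal.span_singleton_pow,
        Ideal.mem_span_singleton, pi_pow_dvd_iff] at this
      exact this i
    refine ⟨fun i => PowerSeries.mk fun j => PowerSeries.coeff j (f (j + 1) i), fun m => ?_⟩
    rw [SModEq.sub_mem, smul_eq_mul, Ideal.mul_top, Ideal.span_singleton_pow,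
      Ideal.mem_span_singleton, pi_pow_dvd_iff]
    intro i
    rw [PowerSeries.X_pow_dvd_iff]
    intro j hj
    have := PowerSeries.X_pow_dvd_iff.mp (hdvd (Nat.succ_le_of_lt hj) i) j j.lt_succ_self
    rw [map_sub, sub_eq_zero] at this
    simp [← this]

end PiPowerSeries

/-! ### Germs with smooth branches and prescribed tangents. -/

section SmoothBranches

/-- The complete local ring of `r` smooth branches with tangent directions `a i` and no further
conditions on the terms of order at least `2`. -/
noncomputable abbrev branchAlgebra {k : Type*} [Field k] {n r : ℕ} (a : Fin r → Fin n → k) :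
    Subalgebra k (Fin r → k⟦X⟧) :=
  gluedSubalgebra k (fun _ => PowerSeries.X) fun j i => PowerSeries.C (a i j)

/-- Each projection to a branch is onto `k⟦X⟧`: `a i ≠ 0` lets the linear term be arbitrary, and
higher terms are free. The kernels intersect in zero, so every minimal prime is one of them. Two
branches produce zero divisors, which excludes a smooth point. -/
theorem isSingularWithSmoothBranches_of_equiv {k : Type u} [Field k] {n r : ℕ} {a : Fin r → Fin n → k}
    (ha : ∀ i, a i ≠ 0) (hr : 2 ≤ r) {R : Type u} [CommRing R] [Algebra k R]
    (e : R ≃ₐ[k] branchAlgebra a) : IsSingularWithSmoothBranches k R := by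
  classical
  let π (i : Fin r) : R →ₐ[k] k⟦X⟧ := (Pi.evalAlgHom k (fun _ : Fin r => k⟦X⟧) i).comp
    ((branchAlgebra a).val.comp e.toAlgHom)
  have hπ (x : R) (h : ∀ i, π i x = 0) : x = 0 := by
    apply e.injective
    apply Subtype.val_injective
    rw [map_zero]
    exact funext h
  have hsurj (i : Fin r) : Function.Surjective (π i) := by
    intro f
    obtain ⟨c, hc⟩ := Function.ne_iff.mp (ha i)
    let β : Fin n → k := Pi.single c (PowerSeries.coeff 1 f / a i c)
    have h : PowerSeries.X ^ 2 ∣ f - (PowerSeries.C (PowerSeries.constantCoeff f) +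
        PowerSeries.X * PowerSeries.C (PowerSeries.coeff 1 f)) := by
      rw [PowerSeries.X_pow_dvd_iff]
      intro m hm
      interval_cases m
      · simp
      · simp
    obtain ⟨g, hg⟩ := h
    let F : Fin r → k⟦X⟧ := algebraMap k _ (PowerSeries.constantCoeff f) +
      (fun _ => PowerSeries.X) * ∑ j, β j • (fun i => PowerSeries.C (a i j)) +
      (fun _ => PowerSeries.X) ^ 2 * fun _ => g
    have hF : F ∈ branchAlgebra a := ⟨_, _, _, rfl⟩
    refine ⟨e.symm ⟨F, hF⟩, ?_⟩
    change (e (e.symm ⟨F, hF⟩)).1 i = f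
    rw [e.apply_symm_apply]
    have hs : (∑ j, β j • (fun i => PowerSeries.C (a i j)) : Fin r → k⟦X⟧) i =
        PowerSeries.C (PowerSeries.coeff 1 f) := by
      rw [Finset.sum_apply, Finset.sum_eq_single c]
      · rw [Pi.smul_apply, PowerSeries.smul_eq_C_mul, ← map_mul]
        simp only [β, Pi.single_eq_same]
        rw [div_mul_cancel₀ _ hc]
      · intro j _ hj
        simp [β, hj]
      · simp
    change algebraMap k k⟦X⟧ _ + PowerSeries.X * (∑ j, β j • (fun i => PowerSeries.C (a i j)) :
      Fin r → k⟦X⟧) i + PowerSeries.X ^ 2 * g = f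
    rw [hs, ← hg, PowerSeries.algebraMap_apply, Algebra.algebraMap_self, RingHom.id_apply]
    ring
  refine ⟨⟨fun x hx => ?_⟩, fun p hp => ?_, ⟨fun E => ?_⟩⟩
  · refine hπ x fun i => ?_
    obtain ⟨m, hm⟩ := hx
    exact eq_zero_of_pow_eq_zero (by rw [← map_pow, hm, map_zero])
  · have hpp : p.IsPrime := hp.1.1
    have hle : ∏ i : Fin r, RingHom.ker (π i) ≤ p := by
      refine (Ideal.prod_le_inf).trans fun x hx => ?_
      rw [Submodule.mem_finsetInf] at hx
      rw [hπ x fun i => hx i (Finset.mem_univ i)]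
      exact p.zero_mem
    obtain ⟨i, -, hi⟩ := (hpp.prod_le).mp hle
    have hker : (RingHom.ker (π i)).IsPrime := RingHom.ker_isPrime _
    have : p = RingHom.ker (π i) := le_antisymm (hp.2 ⟨hker, bot_le⟩ hi) hi
    subst this
    exact ⟨Ideal.quotientKerAlgEquivOfSurjective (hsurj i)⟩
  · have : IsDomain R := E.toRingEquiv.toMulEquiv.isDomain _
    let F (i : Fin r) : Fin r → k⟦X⟧ := (fun _ => PowerSeries.X) ^ 2 * Pi.single i 1
    have hF (i : Fin r) : F i ∈ branchAlgebra a := ⟨0, 0, Pi.single i 1, by simp [F]⟩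
    let i₀ : Fin r := ⟨0, by omega⟩
    let i₁ : Fin r := ⟨1, by omega⟩
    have hne : i₀ ≠ i₁ := by simp [i₀, i₁]
    have h0 (i : Fin r) : (⟨F i, hF i⟩ : branchAlgebra a) ≠ 0 := by
      intro h
      have := congrFun (congrArg Subtype.val h) i
      simp [F] at this
    have hmul : e.symm ⟨F i₀, hF i₀⟩ * e.symm ⟨F i₁, hF i₁⟩ = 0 := by
      rw [← map_mul, map_eq_zero_iff _ e.symm.injective]
      apply Subtype.val_injective
      change F i₀ * F i₁ = 0
      ext1 i
      rcases eq_or_ne i i₀ with rfl | h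
      · simp [F, hne]
      · simp [F, h]
    rcases mul_eq_zero.mp hmul with h | h
    · exact h0 _ ((map_eq_zero_iff _ e.symm.injective).mp h)
    · exact h0 _ ((map_eq_zero_iff _ e.symm.injective).mp h)

end SmoothBranches

/-! ### Dependence of a glued subalgebra on its data. -/

section Congr

/-- Changes of `g * p j` modulo `g' ^ 2` are absorbed by the last summand, so only first-order data
along `g'` matter. -/
theorem gluedSubalgebra_le {K S : Type*} [CommRing K] [CommRing S] [Algebra K S] {n : ℕ}
    {g g' : S} {p p' : Fin n → S} (hg : g' ^ 2 ∣ g ^ 2) (hp : ∀ j, g' ^ 2 ∣ g * p j - g' * p' j) :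
    gluedSubalgebra K g p ≤ gluedSubalgebra K g' p' := by
  rintro _ ⟨α, β, h, rfl⟩
  obtain ⟨w, hw⟩ := hg
  choose v hv using hp
  refine ⟨α, β, ∑ j, β j • v j + w * h, ?_⟩
  have : g * ∑ j, β j • p j = g' * ∑ j, β j • p' j + g' ^ 2 * ∑ j, β j • v j := by
    simp only [Finset.mul_sum, mul_smul_comm, ← hv, ← Finset.sum_add_distrib, ← smul_add]
    exact Finset.sum_congr rfl fun j _ => by ring_nf
  rw [this, hw]
  ring

theorem gluedSubalgebra_congr {K S : Type*} [CommRing K] [CommRing S] [Algebra K S] {n : ℕ}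
    {g g' : S} {p p' : Fin n → S} (hg : g ^ 2 ∣ g' ^ 2) (hg' : g' ^ 2 ∣ g ^ 2)
    (hp : ∀ j, g' ^ 2 ∣ g * p j - g' * p' j) :
    gluedSubalgebra K g p = gluedSubalgebra K g' p' :=
  le_antisymm (gluedSubalgebra_le hg' hp) (gluedSubalgebra_le hg fun j =>
    hg.trans ((dvd_sub_comm).mp (hp j)))

end Congr

/-! ### Germs of glued affine lines. -/

section Germs

variable {k : Type*} [Field k] {n r : ℕ}

/-- The inclusion of polynomials into power series. -/
noncomputable def polynomialToPowerSeries (k : Type*) [Field k] : k[X] →ₐ[k] k⟦X⟧ :=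
  { Polynomial.coeToPowerSeries.ringHom with
    commutes' := fun c => by simp }

@[simp]
theorem polynomialToPowerSeries_apply (f : k[X]) : polynomialToPowerSeries k f = (f : k⟦X⟧) := rfl

theorem X_pow_dvd_coe_iff {m : ℕ} {f : k[X]} :
    (PowerSeries.X : k⟦X⟧) ^ m ∣ (f : k⟦X⟧) ↔ Polynomial.X ^ m ∣ f := by
  rw [PowerSeries.X_pow_dvd_iff, Polynomial.X_pow_dvd_iff]
  simp

theorem X_pow_dvd_coe_trunc_sub (m : ℕ) (s : k⟦X⟧) :
    (PowerSeries.X : k⟦X⟧) ^ m ∣ (PowerSeries.trunc m s : k⟦X⟧) - s := by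
  rw [PowerSeries.X_pow_dvd_iff]
  intro i hi
  rw [map_sub, Polynomial.coeff_coe, PowerSeries.coeff_trunc, if_pos hi, sub_self]

/-- The germ of a curve obtained from the affine line by gluing at the `d`-fold point `t = 0`. -/
theorem nonempty_adicCompletion_equiv_of_X_pow {R : Type*} [CommRing R] [Algebra k R] {d : ℕ}
    (hd : d ≠ 0) {p : Fin n → k[X]} {ψ : R →ₐ[k] k[X]} (hψ : Function.Injective ψ)
    (hrange : ψ.range = gluedSubalgebra k (Polynomial.X ^ d) p) {I : Ideal R}
    (hI₁ : ∀ r ∈ I, Polynomial.X ^ d ∣ ψ r) (hI₂ : ∀ r, (Polynomial.X ^ d) ^ 2 ∣ ψ r → r ∈ I) :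
    Nonempty (AdicCompletion I R ≃ₐ[k]
      gluedSubalgebra k (PowerSeries.X ^ d : k⟦X⟧) (fun j => (p j : k⟦X⟧))) := by
  have hX : polynomialToPowerSeries k (Polynomial.X ^ d) = PowerSeries.X ^ d := by
    rw [map_pow, polynomialToPowerSeries_apply, Polynomial.coe_X]
  have := nonempty_adicCompletion_equiv hψ hrange hI₁ hI₂ (polynomialToPowerSeries k) PowerSeries.X
    (hX ▸ dvd_pow_self _ hd)
    (fun m => ⟨d * m, fun f hf => by rw [← pow_mul]; exact X_pow_dvd_coe_iff.mp hf⟩)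
    (fun s m => ⟨PowerSeries.trunc m s, X_pow_dvd_coe_trunc_sub m s⟩)
    ⟨d * 2, by rw [hX, ← pow_mul]⟩
  rw [hX] at this
  exact this

theorem X_pow_dvd_taylor_iff {c : k} {m : ℕ} {f : k[X]} :
    Polynomial.X ^ m ∣ Polynomial.taylor c f ↔ (Polynomial.X - Polynomial.C c) ^ m ∣ f := by
  rw [Polynomial.X_sub_C_pow_dvd_iff, Polynomial.taylor_apply]

theorem exists_X_pow_dvd_taylor_sub {x : Fin r → k} (hx : Function.Injective x)
    (s : Fin r → k⟦X⟧) (m : ℕ) :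
    ∃ f : k[X], ∀ i, PowerSeries.X ^ m ∣ (Polynomial.taylor (x i) f : k⟦X⟧) - s i := by
  let J (i : Fin r) : Ideal k[X] := Ideal.span {(Polynomial.X - Polynomial.C (x i)) ^ m}
  have hJ : Pairwise (Function.onFun IsCoprime J) := fun i j hij => by
    rw [Function.onFun, Ideal.isCoprime_span_singleton_iff]
    exact (Polynomial.pairwise_coprime_X_sub_C hx hij).pow
  obtain ⟨f, hf⟩ := Ideal.exists_forall_sub_mem_ideal hJ
    fun i => Polynomial.taylor (-x i) (PowerSeries.trunc m (s i))
  refine ⟨f, fun i => ?_⟩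
  have h1 := Ideal.mem_span_singleton.mp (hf i)
  rw [← X_pow_dvd_taylor_iff, map_sub, Polynomial.taylor_taylor, add_neg_cancel,
    Polynomial.taylor_zero, ← X_pow_dvd_coe_iff, Polynomial.coe_sub] at h1
  simpa using dvd_add h1 (X_pow_dvd_coe_trunc_sub m (s i))

/-- The germ of a curve obtained from the affine line by gluing at `r` distinct points. -/
theorem nonempty_adicCompletion_equiv_of_prod {R : Type*} [CommRing R] [Algebra k R]
    {x : Fin r → k} (hx : Function.Injective x) {g : k[X]}
    (hg : g = ∏ i, (Polynomial.X - Polynomial.C (x i)))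
    {p : Fin n → k[X]} {ψ : R →ₐ[k] k[X]} (hψ : Function.Injective ψ)
    (hrange : ψ.range = gluedSubalgebra k g p) {I : Ideal R}
    (hI₁ : ∀ r ∈ I, g ∣ ψ r) (hI₂ : ∀ r, g ^ 2 ∣ ψ r → r ∈ I) :
    Nonempty (AdicCompletion I R ≃ₐ[k]
      branchAlgebra fun i j => g.derivative.eval (x i) * (p j).eval (x i)) := by
  -- Simultaneous Taylor expansion at all the glued points. Its image is dense by the Chinese
  -- remainder theorem.
  let θ : k[X] →ₐ[k] (Fin r → k⟦X⟧) := AlgHom.pi fun i =>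
    (polynomialToPowerSeries k).comp (Polynomial.taylorAlgHom (x i))
  have hθ (f : k[X]) (i : Fin r) : θ f i = (Polynomial.taylor (x i) f : k⟦X⟧) := rfl
  have hroot (i : Fin r) : g.eval (x i) = 0 := by
    rw [hg, Polynomial.eval_prod]
    exact Finset.prod_eq_zero (Finset.mem_univ i) (by simp)
  have hder (i : Fin r) : g.derivative.eval (x i) ≠ 0 := by
    have hsep : g.Separable := by
      rw [hg, Polynomial.separable_prod_X_sub_C_iff]
      exact hx
    have := hsep.aeval_derivative_ne_zero (x := x i) (by simpa using hroot i)
    simpa using this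
  have hdvd (i : Fin r) : PowerSeries.X ∣ θ g i := by
    rw [hθ, PowerSeries.X_dvd_iff, ← PowerSeries.coeff_zero_eq_constantCoeff_apply,
      Polynomial.coeff_coe, Polynomial.taylor_coeff_zero, hroot]
  choose w hw using hdvd
  have hw' : θ g = (fun _ => PowerSeries.X) * w := funext hw
  have hw0 (i : Fin r) : PowerSeries.constantCoeff (w i) = g.derivative.eval (x i) := by
    rw [← Polynomial.taylor_coeff_one, ← Polynomial.coeff_coe, ← hθ, hw,
      ← PowerSeries.coeff_zero_eq_constantCoeff_apply]
    exact (PowerSeries.coeff_succ_X_mul 0 (w i)).symm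
  -- The roots of `g` are simple, so `g` is a local parameter at each of them, with leading
  -- coefficient `g'(x i)`.
  have hwu : IsUnit w := by
    rw [Pi.isUnit_iff]
    intro i
    rw [PowerSeries.isUnit_iff_constantCoeff, hw0]
    exact (hder i).isUnit
  have h4 : θ g ^ 2 ∣ (fun _ => PowerSeries.X) ^ 2 := by
    rw [hw', mul_pow]
    exact ((hwu.pow 2).mul_right_dvd).mpr dvd_rfl
  have key := nonempty_adicCompletion_equiv hψ hrange hI₁ hI₂ θ (fun _ => PowerSeries.X)
    ⟨w, hw'⟩ (fun m => ⟨m, fun f hf => ?_⟩) (fun s m => ?_) ⟨2, h4⟩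
  · have : gluedSubalgebra k (θ g) (θ ∘ p) =
        branchAlgebra fun i j => g.derivative.eval (x i) * (p j).eval (x i) := by
      refine gluedSubalgebra_congr h4 (pow_dvd_pow_of_dvd ⟨w, hw'⟩ 2) fun j => ?_
      rw [pi_pow_dvd_iff]
      intro i
      simp only [Pi.sub_apply, Pi.mul_apply, Function.comp, hw i, mul_assoc, ← mul_sub, pow_two]
      refine mul_dvd_mul_left _ ?_
      rw [PowerSeries.X_dvd_iff, map_sub, map_mul, hw0, PowerSeries.constantCoeff_C, hθ,
        ← PowerSeries.coeff_zero_eq_constantCoeff_apply, Polynomial.coeff_coe,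
        Polynomial.taylor_coeff_zero, sub_self]
    rw [← this]
    exact key
  · rw [pi_pow_dvd_iff] at hf
    rw [hg, ← Finset.prod_pow]
    refine Finset.prod_dvd_of_coprime (fun i _ j _ hij => ?_) fun i _ => ?_
    · exact (Polynomial.pairwise_coprime_X_sub_C hx hij).pow
    · exact X_pow_dvd_taylor_iff.mp (X_pow_dvd_coe_iff.mp (hf i))
  · obtain ⟨f, hf⟩ := exists_X_pow_dvd_taylor_sub hx s m
    exact ⟨f, pi_pow_dvd_iff.mpr hf⟩

end Germs

/-! ### Germs at the origin of parametrized unions of branches. -/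

section ParametrizedCurves

variable {k : Type*} [Field k] [Infinite k] {n r : ℕ} {σ : Type}

/-- The germ at the origin of a union of smooth branches `t ↦ (t a i, …)` whose coordinate ring
contains all functions vanishing to order two. -/
theorem nonempty_germAtOrigin_equiv {γ : Fin r → σ → k[X]} {a : Fin r → Fin n → k}
    {Z : Set (σ → k)} (hZ : Z = {x | ∃ i t, x = fun j => (γ i j).eval t})
    (c : Fin n → σ) (hc : ∀ i l, γ i (c l) = Polynomial.X * Polynomial.C (a i l))
    (hγ : ∀ j, (∃ l, c l = j) ∨ ∀ i, Polynomial.X ^ 2 ∣ γ i j) (ha : ∀ i, a i ≠ 0)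
    (hsq : ∀ i, ∃ f ∈ Ideal.span (Set.range (MvPolynomial.X : σ → MvPolynomial σ k)), ∀ i',
      MvPolynomial.aeval (γ i') f = Pi.single (M := fun _ => k[X]) i (Polynomial.X ^ 2) i') :
    Nonempty (germAtOrigin Z ≃ₐ[k] branchAlgebra a) := by
  set 𝔪 : Ideal (MvPolynomial σ k) := Ideal.span (Set.range MvPolynomial.X) with h𝔪
  let Γ : MvPolynomial σ k →ₐ[k] (Fin r → k[X]) := AlgHom.pi fun i => MvPolynomial.aeval (γ i)
  have hΓ (f : MvPolynomial σ k) (i : Fin r) : Γ f i = MvPolynomial.aeval (γ i) f := rfl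
  -- Over an infinite field, vanishing on the points of `Z` is the same as vanishing after
  -- substituting each parametrization.
  have hker (f : MvPolynomial σ k) : f ∈ MvPolynomial.vanishingIdeal k Z ↔ Γ f = 0 := by
    have heval (i : Fin r) (t : k) : (Γ f i).eval t =
        MvPolynomial.aeval (fun j => (γ i j).eval t) f := by
      rw [hΓ, ← Polynomial.coe_aeval_eq_eval, ← AlgHom.comp_apply, MvPolynomial.comp_aeval]
    rw [MvPolynomial.mem_vanishingIdeal_iff, hZ]
    constructor
    · intro h
      ext1 i
      refine Polynomial.funext fun t => ?_
      rw [heval, h _ ⟨i, t, rfl⟩]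
      simp
    · rintro h _ ⟨i, t, rfl⟩
      rw [← heval, h]
      simp
  let ψ : coordRing Z →ₐ[k] (Fin r → k[X]) :=
    Ideal.Quotient.liftₐ _ Γ fun f hf => (hker f).mp hf
  have hψmk (f : MvPolynomial σ k) : ψ (Ideal.Quotient.mk _ f) = Γ f := rfl
  have hψ : Function.Injective ψ := by
    rw [injective_iff_map_eq_zero]
    intro y hy
    obtain ⟨f, rfl⟩ := Ideal.Quotient.mk_surjective y
    exact Ideal.Quotient.eq_zero_iff_mem.mpr ((hker f).mpr hy)
  have hsingle (i : Fin r) (h : k[X]) : ∃ f ∈ 𝔪, Γ f = Pi.single i (Polynomial.X ^ 2 * h) := by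
    induction h using Polynomial.induction_on with
    | C b =>
      obtain ⟨f, hf, hf'⟩ := hsq i
      refine ⟨f * MvPolynomial.C b, 𝔪.mul_mem_right _ hf, ?_⟩
      ext1 i'
      rw [hΓ, map_mul, hf' i', MvPolynomial.aeval_C, ← Polynomial.C_eq_algebraMap]
      rcases eq_or_ne i' i with rfl | hne
      · simp
      · simp [hne]
    | add h h' ih ih' =>
      obtain ⟨f, hf, e⟩ := ih
      obtain ⟨f', hf', e'⟩ := ih'
      exact ⟨f + f', 𝔪.add_mem hf hf', by rw [map_add, e, e', mul_add, Pi.single_add]⟩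
    | monomial l b ih =>
      obtain ⟨f, hf, e⟩ := ih
      obtain ⟨l', hl'⟩ := Function.ne_iff.mp (ha i)
      -- A coordinate with `a i l' ≠ 0`, divided by that number, restricts to the parameter on
      -- branch `i`. Multiplying by it raises the power without disturbing the other branches, where
      -- `f` is zero.
      refine ⟨f * (MvPolynomial.X (c l') * MvPolynomial.C (a i l')⁻¹), 𝔪.mul_mem_right _ hf, ?_⟩
      rw [map_mul, e]
      ext1 i'
      rw [Pi.mul_apply, hΓ]
      rcases eq_or_ne i' i with rfl | hne
      · rw [Pi.single_eq_same, Pi.single_eq_same, map_mul, MvPolynomial.aeval_X, hc,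
          MvPolynomial.aeval_C, ← Polynomial.C_eq_algebraMap, mul_assoc Polynomial.X,
          ← Polynomial.C_mul, mul_inv_cancel₀ hl', Polynomial.C_1]
        ring
      · rw [Pi.single_eq_of_ne hne, Pi.single_eq_of_ne hne, zero_mul]
  have hsq' (h : Fin r → k[X]) : ∃ f ∈ 𝔪, Γ f = (fun _ => Polynomial.X) ^ 2 * h := by
    choose f hf e using hsingle
    refine ⟨∑ i, f i (h i), 𝔪.sum_mem fun i _ => hf i _, ?_⟩
    rw [map_sum]
    simp only [e]
    exact Finset.univ_sum_single (fun i => Polynomial.X ^ 2 * h i)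
  let P (l : Fin n) : Fin r → k[X] := fun i => Polynomial.C (a i l)
  have hΓc (l : Fin n) : Γ (MvPolynomial.X (c l)) = (fun _ => Polynomial.X) * P l := by
    ext1 i
    rw [hΓ, MvPolynomial.aeval_X, hc]
    rfl
  have hrange : ψ.range = gluedSubalgebra k (fun _ => Polynomial.X) P := by
    apply le_antisymm
    · rintro _ ⟨y, rfl⟩
      obtain ⟨f, rfl⟩ := Ideal.Quotient.mk_surjective y
      change Γ f ∈ _
      induction f using MvPolynomial.induction_on with
      | C b => exact ⟨b, 0, 0, by simp [← MvPolynomial.algebraMap_eq]⟩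
      | add f f' hf hf' => rw [map_add]; exact Subalgebra.add_mem _ hf hf'
      | mul_X f j hf =>
        rw [map_mul]
        refine Subalgebra.mul_mem _ hf ?_
        rcases hγ j with ⟨l, rfl⟩ | hj
        · refine ⟨0, Pi.single l 1, 0, ?_⟩
          rw [hΓc]
          simp [Pi.single_apply]
        · choose h hh using hj
          refine ⟨0, 0, h, ?_⟩
          ext1 i
          rw [hΓ, MvPolynomial.aeval_X, hh]
          simp
    · rintro _ ⟨α, β, h, rfl⟩
      obtain ⟨f, -, hf⟩ := hsq' h
      refine ⟨Ideal.Quotient.mk _ (algebraMap k _ α + ∑ l, β l • MvPolynomial.X (c l) + f), ?_⟩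
      change Γ _ = _
      rw [map_add, map_add, hf, map_sum, AlgHom.commutes, Finset.mul_sum]
      simp only [map_smul, hΓc, mul_smul_comm]
  let θ : (Fin r → k[X]) →ₐ[k] (Fin r → k⟦X⟧) := AlgHom.pi fun i =>
    (polynomialToPowerSeries k).comp (Pi.evalAlgHom k _ i)
  have hθ (f : Fin r → k[X]) (i : Fin r) : θ f i = (f i : k⟦X⟧) := rfl
  have hθX : θ (fun _ => Polynomial.X) = fun _ => PowerSeries.X :=
    funext fun i => Polynomial.coe_X
  have key := nonempty_adicCompletion_equiv hψ hrange (I := 𝔪.map (Ideal.Quotient.mk _))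
    (fun y hy => ?_) (fun y hy => ?_) θ (fun _ => PowerSeries.X) (dvd_of_eq hθX.symm)
    (fun m => ⟨m, fun f hf => ?_⟩) (fun s m => ?_) ⟨2, dvd_of_eq (by rw [hθX])⟩
  · have hθP : θ ∘ P = fun l i => PowerSeries.C (a i l) :=
      funext fun l => funext fun i => Polynomial.coe_C _
    rw [hθX, hθP] at key
    exact key
  · have : 𝔪.map (Ideal.Quotient.mk (MvPolynomial.vanishingIdeal k Z)) ≤
        (Ideal.span {(fun _ => Polynomial.X : Fin r → k[X])}).comap ψ := by
      rw [Ideal.map_le_iff_le_comap, h𝔪, Ideal.span_le]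
      rintro _ ⟨j, rfl⟩
      rw [SetLike.mem_coe, Ideal.mem_comap, Ideal.mem_comap, hψmk, Ideal.mem_span_singleton,
        pi_dvd_iff]
      intro i
      rw [hΓ, MvPolynomial.aeval_X]
      rcases hγ j with ⟨l, rfl⟩ | hj
      · exact ⟨_, hc i l⟩
      · exact (dvd_pow_self _ two_ne_zero).trans (hj i)
    exact Ideal.mem_span_singleton.mp (this hy)
  · obtain ⟨h, hh⟩ := hy
    obtain ⟨f, hf, e⟩ := hsq' h
    rw [show y = Ideal.Quotient.mk _ f from hψ (by rw [hh, hψmk, e])]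
    exact Ideal.mem_map_of_mem _ hf
  · rw [pi_pow_dvd_iff] at hf ⊢
    exact fun i => X_pow_dvd_coe_iff.mp (hf i)
  · exact ⟨fun i => PowerSeries.trunc m (s i),
      pi_pow_dvd_iff.mpr fun i => X_pow_dvd_coe_trunc_sub m (s i)⟩

end ParametrizedCurves

/-! ### Identification with the singularities `L` and `S`. -/

section Targets

theorem degree_eq_of_mem_support {R σ : Type*} [CommSemiring R] {m : ℕ} {f : MvPolynomial σ R}
    (hf : f.IsHomogeneous m) {α : σ →₀ ℕ} (hα : α ∈ f.support) : α.degree = m := by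
  rw [Finsupp.degree_eq_weight_one]
  exact hf (MvPolynomial.mem_support_iff.mp hα)

theorem aeval_X_mul_C_of_isHomogeneous {k : Type*} [Field k] {n m : ℕ} {f : MvPolynomial (Fin n) k}
    (hf : f.IsHomogeneous m) (a : Fin n → k) :
    MvPolynomial.aeval (fun l => Polynomial.X * Polynomial.C (a l)) f =
      Polynomial.X ^ m * Polynomial.C (MvPolynomial.aeval a f) := by
  rw [MvPolynomial.aeval_def, MvPolynomial.aeval_def, MvPolynomial.eval₂_eq', MvPolynomial.eval₂_eq',
    map_sum, Finset.mul_sum]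
  refine Finset.sum_congr rfl fun α hα => ?_
  have hα' : ∑ l, α l = m := by
    rw [← degree_eq_of_mem_support hf hα, Finsupp.degree_eq_sum]
  simp only [mul_pow, Finset.prod_mul_distrib, Finset.prod_pow_eq_pow_sum, hα', map_mul, map_prod,
    map_pow, ← Polynomial.C_eq_algebraMap, Algebra.algebraMap_self, RingHom.id_apply]
  ring

/-- Quadrics in `n` variables form a space of dimension `(n + 1).choose 2`, so the points of `T`
impose independent conditions on them. -/
theorem IsUniformPosition.exists_quadric {k : Type*} [Field k] {n r : ℕ} {a : Fin r → Fin n → k}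
    (ha : IsUniformPosition a) {T : Finset (Fin r)} (hT : T.card ≤ (n + 1).choose 2) (i : Fin r) :
    ∃ f : MvPolynomial (Fin n) k, f.IsHomogeneous 2 ∧
      ∀ j ∈ T, MvPolynomial.aeval (a j) f = if j = i then 1 else 0 := by
  have hrank := ha.2.2 T 2 one_le_two
  rw [show n + 2 - 1 = n + 1 from rfl, min_eq_left hT] at hrank
  obtain ⟨f, hf⟩ := formEval_surjective_of_le hrank.ge fun j => if j.1 = i then 1 else 0
  exact ⟨f.1, f.2, fun j hj => congrFun hf ⟨j, hj⟩⟩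

theorem mem_span_range_X_of_isHomogeneous {k σ : Type*} [Field k] {m : ℕ} (hm : m ≠ 0)
    {f : MvPolynomial σ k} (hf : f.IsHomogeneous m) :
    f ∈ Ideal.span (Set.range (MvPolynomial.X : σ → MvPolynomial σ k)) := by
  have := (MvPolynomial.mem_pow_idealOfVars_iff 1 f).mpr fun α hα => by
    rw [degree_eq_of_mem_support hf hα]
    omega
  rwa [pow_one] at this

variable {k : Type u} [Field k] [Infinite k] {n d : ℕ} {a : Fin d → Fin n → k}

/-- A quadric separating `a i` from all the other points restricts to `t^2` on line `i` and to zero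
on the rest, which is what `nonempty_germAtOrigin_equiv` needs. -/
theorem isL_of_equiv (ha : IsUniformPosition a) (hd : d ≤ (n + 1).choose 2)
    {R : Type u} [CommRing R] [Algebra k R] (e : R ≃ₐ[k] branchAlgebra a) : IsL (k := k) d n R := by
  classical
  obtain ⟨e'⟩ := nonempty_germAtOrigin_equiv (Z := lines a)
    (γ := fun i l => Polynomial.X * Polynomial.C (a i l)) (a := a)
    (by
      ext x
      simp only [lines, Set.mem_ofPred_eq, Polynomial.eval_mul, Polynomial.eval_X,
        Polynomial.eval_C]
      rfl) id (fun _ _ => rfl) (fun j => Or.inl ⟨j, rfl⟩) ha.1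
    fun i => by
      obtain ⟨f, hf, hf'⟩ := ha.exists_quadric (T := Finset.univ) (by simpa using hd) i
      refine ⟨f, mem_span_range_X_of_isHomogeneous two_ne_zero hf, fun i' => ?_⟩
      rw [aeval_X_mul_C_of_isHomogeneous hf, hf' i' (Finset.mem_univ _)]
      rcases eq_or_ne i' i with rfl | hne
      · simp
      · simp [hne]
  exact ⟨a, ha, ⟨e.trans e'.symm⟩⟩

/-- Every branch beyond the first `(n + 1).choose 2` gets its own new coordinate, which isolates
`t^2` on it. The first branches are isolated by quadrics, corrected by these coordinates. -/
theorem isS_of_equiv (ha : IsUniformPosition a)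
    {R : Type u} [CommRing R] [Algebra k R] (e : R ≃ₐ[k] branchAlgebra a) :
    IsS (k := k) d n (max n (n + d - (n + 1).choose 2)) R := by
  classical
  set B := (n + 1).choose 2
  set N := max n (n + d - B) with hN
  have hlt {i : Fin d} (hi : B ≤ i.1) : i.1 - B < N - n := by have := i.2; omega
  let b (i : Fin d) : Fin (N - n) → k := if h : B ≤ i.1 then Pi.single ⟨i.1 - B, hlt h⟩ 1 else 0
  have hb {i : Fin d} (hi : B ≤ i.1) : b i = Pi.single ⟨i.1 - B, hlt hi⟩ 1 := dif_pos hi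
  have hb' {i : Fin d} (hi : i.1 < B) : b i = 0 := dif_neg (by omega)
  let γ (i : Fin d) : Fin n ⊕ Fin (N - n) → k[X] :=
    Sum.elim (fun l => Polynomial.X * Polynomial.C (a i l))
      (fun j => Polynomial.X ^ 2 * Polynomial.C (b i j))
  have hlarge (i : Fin d) (hi : B ≤ i.1) :
      ∃ f ∈ Ideal.span (Set.range (MvPolynomial.X : _ → MvPolynomial (Fin n ⊕ Fin (N - n)) k)),
        ∀ i', MvPolynomial.aeval (γ i') f =
          Pi.single (M := fun _ => k[X]) i (Polynomial.X ^ 2) i' := by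
    refine ⟨MvPolynomial.X (Sum.inr ⟨i.1 - B, hlt hi⟩), Ideal.subset_span ⟨_, rfl⟩, fun i' => ?_⟩
    rw [MvPolynomial.aeval_X]
    change Polynomial.X ^ 2 * Polynomial.C (b i' _) = _
    rcases eq_or_ne i' i with rfl | hne
    · simp [hb hi]
    · rw [Pi.single_eq_of_ne hne]
      rcases lt_or_ge i'.1 B with h | h
      · simp [hb' h]
      · rw [hb h, Pi.single_eq_of_ne, map_zero, mul_zero]
        intro heq
        have := congrArg Fin.val heq
        simp only at this
        exact hne (Fin.ext (by omega))
  choose F hF hF' using hlarge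
  obtain ⟨e'⟩ := nonempty_germAtOrigin_equiv (Z := parabolas a b) (γ := γ) (a := a)
    (by
      ext x
      simp only [parabolas, Set.mem_ofPred_eq]
      refine exists_congr fun i => exists_congr fun t => ?_
      have : (fun j => (γ i j).eval t) = Sum.elim (t • a i) (t ^ 2 • b i) := by
        ext (j | j) <;>
          simp only [γ, Sum.elim_inl, Sum.elim_inr, Polynomial.eval_mul, Polynomial.eval_X,
            Polynomial.eval_pow, Polynomial.eval_C, Pi.smul_apply, smul_eq_mul]
      rw [this])
    Sum.inl (fun _ _ => rfl)
    (by
      rintro (l | j)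
      · exact Or.inl ⟨l, rfl⟩
      · exact Or.inr fun i => ⟨_, rfl⟩) ha.1
    fun i => by
      rcases le_or_gt B i.1 with hi | hi
      · exact ⟨F i hi, hF i hi, hF' i hi⟩
      obtain ⟨f, hf, hf'⟩ := ha.exists_quadric
        (T := Finset.univ.filter fun j : Fin d => j.1 < B)
        ((Finset.card_le_card_of_injOn (t := Finset.range B) Fin.val
          (fun j hj => by simpa using hj) Fin.val_injective.injOn).trans (Finset.card_range B).le)
        i
      -- The quadric is controlled only on the first `B` branches. On a later branch `j` it
      -- restricts to its value at `a j` times `t^2`, which the matching multiple of `F j` removes.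
      refine ⟨MvPolynomial.rename Sum.inl f - ∑ j : {j : Fin d // B ≤ j.1},
        MvPolynomial.C (MvPolynomial.aeval (a j) f) * F j.1 j.2, ?_, fun i' => ?_⟩
      · exact Ideal.sub_mem _
          (mem_span_range_X_of_isHomogeneous two_ne_zero (hf.rename_isHomogeneous))
          (Ideal.sum_mem _ fun j _ => Ideal.mul_mem_left _ _ (hF j.1 j.2))
      · have h1 : MvPolynomial.aeval (γ i') (MvPolynomial.rename Sum.inl f) =
            Polynomial.X ^ 2 * Polynomial.C (MvPolynomial.aeval (a i') f) := by
          rw [MvPolynomial.aeval_rename, ← aeval_X_mul_C_of_isHomogeneous hf]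
          rfl
        rw [map_sub, h1, map_sum]
        simp only [map_mul, hF', MvPolynomial.aeval_C, ← Polynomial.C_eq_algebraMap]
        rcases lt_or_ge i'.1 B with h | h
        · rw [Finset.sum_eq_zero, hf' i' (by simpa using h)]
          · rcases eq_or_ne i' i with rfl | hne
            · simp
            · simp [hne]
          · intro j _
            rw [Pi.single_eq_of_ne, mul_zero]
            rintro rfl
            have := j.2
            omega
        · have hne : i' ≠ i := by rintro rfl; omega
          rw [Pi.single_eq_of_ne hne, Finset.sum_eq_single ⟨i', h⟩]
          · simp only [Pi.single_eq_same]; ring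
          · intro j _ hj
            rw [Pi.single_eq_of_ne, mul_zero]
            rintro rfl
            exact hj rfl
          · simp
  refine ⟨le_max_left _ _, a, b, ha, fun i hi => hb' hi, fun i hi => ⟨_, hb hi⟩, fun j => ?_,
    ⟨e.trans e'.symm⟩⟩
  have hj := j.2
  exact ⟨⟨B + j.1, by omega⟩, by rw [hb (Nat.le_add_right _ _)]; congr; simp⟩

end Targets

/-! ### The gluing family and its fibres. -/

section Family

variable {k : Type u} [Field k] {n : ℕ}

theorem eval_eval_eq_eval_map (s : k) (ρ : k[X]) (f : k[X][X]) :
    (f.eval ρ).eval s = (f.map (Polynomial.evalRingHom s)).eval (ρ.eval s) := by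
  rw [Polynomial.eval_map]
  exact (Polynomial.eval₂_at_apply (Polynomial.evalRingHom s) ρ).symm

/-- Since `G^2` lies in the subalgebra, `X` is a root of the monic polynomial `G(Y)^2 - G(X)^2` over
it. -/
theorem isIntegral_gluedSubalgebra {K : Type*} [CommRing K] [Nontrivial K] {G : K[X]}
    (hG : G.Monic) (hdeg : G.natDegree ≠ 0) (P : Fin n → K[X]) :
    Algebra.IsIntegral (gluedSubalgebra K G P) K[X] := by
  set A := gluedSubalgebra K G P
  have hmem : G ^ 2 ∈ A := ⟨0, 0, 1, by simp⟩
  have hX : IsIntegral A (Polynomial.X : K[X]) := by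
    have : Nontrivial A := A.toSubring.nontrivial
    have hm : ((G ^ 2).map (algebraMap K A)).Monic := (hG.pow 2).map _
    refine ⟨(G ^ 2).map (algebraMap K A) - Polynomial.C ⟨G ^ 2, hmem⟩,
      Polynomial.Monic.sub_of_left hm ?_, ?_⟩
    · refine lt_of_le_of_lt Polynomial.degree_C_le (Polynomial.natDegree_pos_iff_degree_pos.mp ?_)
      rw [(hG.pow 2).natDegree_map, hG.natDegree_pow]
      omega
    · rw [Polynomial.eval₂_sub, Polynomial.eval₂_C, Polynomial.eval₂_map]
      change Polynomial.eval₂ Polynomial.C Polynomial.X (G ^ 2) - G ^ 2 = 0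
      rw [Polynomial.eval₂_C_X, sub_self]
  refine ⟨fun f => ?_⟩
  induction f using Polynomial.induction_on' with
  | add f g hf hg => exact hf.add hg
  | monomial m b =>
    rw [← Polynomial.C_mul_X_pow_eq_monomial]
    exact (isIntegral_algebraMap (x := (algebraMap K A b))).mul (hX.pow m)

theorem flat_subalgebra {K S : Type*} [CommRing K] [IsDedekindDomain K] [CommRing S] [Algebra K S]
    [Module.IsTorsionFree K S] (A : Subalgebra K S) : Module.Flat K A := by
  have : Module.IsTorsionFree K A := Subtype.val_injective.moduleIsTorsionFree _ fun _ _ => rfl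
  infer_instance

/-- The family of curves obtained from the affine line over `k[s]` by gluing along `G = 0`, with the
section through the singular points. -/
noncomputable abbrev gluingFamily {G : k[X][X]} (hG : G.Monic) (hdeg : G.natDegree ≠ 0)
    (P : Fin n → k[X][X]) (ρ : k[X]) : Family k where
  total := gluedSubalgebra k[X] G P
  flat := flat_subalgebra _
  finiteType := by
    have := isIntegral_gluedSubalgebra hG hdeg P
    have : Algebra.FiniteType (gluedSubalgebra k[X] G P) k[X][X] :=
      .of_restrictScalars_finiteType k[X] _ _
    have hfin := Algebra.IsIntegral.finite (R := gluedSubalgebra k[X] G P) (A := k[X][X])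
    exact ⟨fg_of_fg_of_fg k[X] _ k[X][X] (Algebra.FiniteType.out) hfin.1 Subtype.val_injective⟩
  sec := (Polynomial.aeval ρ).comp (gluedSubalgebra k[X] G P).val

/-- Specialisation of the base ring `k[s]` of a glued subalgebra at a point `s`. -/
theorem exists_specialization {G : k[X][X]} {P : Fin n → k[X][X]} {s : k} {g : k[X]}
    {p : Fin n → k[X]} (hg : G.map (Polynomial.evalRingHom s) = g) (hg₁ : g.Monic)
    (hp : ∀ j, (P j).map (Polynomial.evalRingHom s) = p j) {x : k} (hx : g.eval x = 0)
    (hind : ∀ β : Fin n → k, g ∣ ∑ j, β j • p j → β = 0) :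
    ∃ Φ : gluedSubalgebra k[X] G P →ₐ[k] k[X],
      (∀ y, Φ y = y.1.map (Polynomial.evalRingHom s)) ∧ Φ.range = gluedSubalgebra k g p ∧
      ∀ y, y ∈ Ideal.span {algebraMap k[X] (gluedSubalgebra k[X] G P)
        (Polynomial.X - Polynomial.C s)} ↔ Φ y = 0 := by
  let ev : k[X][X] →ₐ[k] k[X] := Polynomial.mapAlgHom (Polynomial.aeval s)
  have hev (f : k[X][X]) : ev f = f.map (Polynomial.evalRingHom s) := by
    rw [Polynomial.coe_mapAlgHom]; rfl
  have hevX (b : k[X]) (f : k[X][X]) : ev (b • f) = b.eval s • ev f := by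
    rw [hev, hev, Polynomial.smul_eq_C_mul, Polynomial.map_mul, Polynomial.map_C,
      Polynomial.smul_eq_C_mul]
    rfl
  have hevC (b : k[X]) : ev (algebraMap k[X] k[X][X] b) = algebraMap k k[X] (b.eval s) := by
    rw [hev]; exact Polynomial.map_C _
  have hevmem (α : k[X]) (β : Fin n → k[X]) (h : k[X][X]) :
      ev (algebraMap k[X] k[X][X] α + G * ∑ j, β j • P j + G ^ 2 * h) =
        algebraMap k k[X] (α.eval s) + g * ∑ j, (β j).eval s • p j + g ^ 2 * ev h := by
    rw [map_add, map_add, map_mul, map_mul, map_pow, map_sum, hevC, hev G, hg]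
    simp only [hevX, hev (P _), hp]
  have hdvd {b : k[X]} (hb : b.eval s = 0) : ∃ b', b = (Polynomial.X - Polynomial.C s) * b' :=
    Polynomial.dvd_iff_isRoot.mpr hb
  refine ⟨ev.comp ((gluedSubalgebra k[X] G P).val.restrictScalars k), fun y => hev y.1,
    le_antisymm ?_ ?_, fun y => ⟨fun hy => ?_, fun hy => ?_⟩⟩
  · rintro _ ⟨⟨y, α, β, h, rfl⟩, rfl⟩
    exact ⟨_, _, _, hevmem α β h⟩
  · rintro _ ⟨α, β, h, rfl⟩
    refine ⟨⟨_, Polynomial.C α, fun j => Polynomial.C (β j), h.map Polynomial.C, rfl⟩,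
      (hevmem (Polynomial.C α) (fun j => Polynomial.C (β j)) (h.map Polynomial.C)).trans ?_⟩
    have hid : (Polynomial.evalRingHom s).comp Polynomial.C = RingHom.id k :=
      RingHom.ext fun b => Polynomial.eval_C
    simp only [hev, Polynomial.map_map, hid, Polynomial.map_id, Polynomial.eval_C]
  · obtain ⟨z, rfl⟩ := Ideal.mem_span_singleton.mp hy
    rw [map_mul]
    refine mul_eq_zero_of_left ((hevC _).trans ?_) _
    simp
  · obtain ⟨y, α, β, h, rfl⟩ := y
    have hy' := (hevmem α β h).symm.trans hy
    -- The three summands are killed in turn: `α` by evaluating at a root of `g`, the `β j` by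
    -- independence modulo `g`, and then `h` because `g^2` is not a zero divisor.
    have hα : α.eval s = 0 := by
      have := congrArg (Polynomial.eval x) hy'
      simpa [hx] using this
    rw [hα, map_zero, zero_add, pow_two, mul_assoc, ← mul_add, mul_eq_zero,
      or_iff_right hg₁.ne_zero] at hy'
    have hβ (j : Fin n) : (β j).eval s = 0 :=
      congrFun (hind (fun j => (β j).eval s) ⟨-ev h, by linear_combination hy'⟩) j
    have hh : ev h = 0 := by
      simp only [hβ, zero_smul, Finset.sum_const_zero, zero_add, mul_eq_zero,
        or_iff_right hg₁.ne_zero] at hy'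
      exact hy'
    obtain ⟨α', rfl⟩ := hdvd hα
    choose β' hβ' using fun j => hdvd (hβ j)
    obtain ⟨h', rfl⟩ : Polynomial.C (Polynomial.X - Polynomial.C s) ∣ h := by
      rw [Polynomial.C_dvd_iff_dvd_coeff]
      intro i
      rw [Polynomial.dvd_iff_isRoot]
      have := congrArg (Polynomial.coeff · i) hh
      simpa [hev] using this
    refine Ideal.mem_span_singleton.mpr ⟨⟨_, α', β', h', rfl⟩, Subtype.ext ?_⟩
    change algebraMap k[X] k[X][X] ((Polynomial.X - Polynomial.C s) * α') + G * ∑ j, β j • P j +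
      G ^ 2 * (Polynomial.C (Polynomial.X - Polynomial.C s) * h') =
      algebraMap k[X] k[X][X] (Polynomial.X - Polynomial.C s) *
      (algebraMap k[X] k[X][X] α' + G * ∑ j, β' j • P j + G ^ 2 * h')
    have : ∑ j, β j • P j =
        Polynomial.C (Polynomial.X - Polynomial.C s) * ∑ j, β' j • P j := by
      simp only [hβ', mul_smul, Finset.mul_sum, Polynomial.smul_eq_C_mul]
    rw [this, RingHom.map_mul, Polynomial.algebraMap_eq]
    ring

/-- Elements of the fibre have the form `α + g (…)`, so vanishing at one root of `g` forces
divisibility by `g`. Hence the ideal of the section does not depend on the root it follows. -/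
theorem exists_fibre_hom {G : k[X][X]} (hG : G.Monic) (hdeg : G.natDegree ≠ 0)
    (P : Fin n → k[X][X]) {ρ : k[X]} (hρ : G.eval ρ = 0) {s : k} {g : k[X]} {p : Fin n → k[X]}
    (hg : G.map (Polynomial.evalRingHom s) = g) (hp : ∀ j, (P j).map (Polynomial.evalRingHom s) = p j)
    (hind : ∀ β : Fin n → k, g ∣ ∑ j, β j • p j → β = 0) :
    ∃ ψ : (gluingFamily hG hdeg P ρ).fibre s →ₐ[k] k[X], Function.Injective ψ ∧
      ψ.range = gluedSubalgebra k g p ∧ ∀ y, y ∈ (gluingFamily hG hdeg P ρ).point s ↔ g ∣ ψ y := by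
  have hgρ : g.eval (ρ.eval s) = 0 := by
    rw [← hg, ← eval_eval_eq_eval_map, hρ, Polynomial.eval_zero]
  obtain ⟨Φ, hΦ, hrange, hker⟩ := exists_specialization hg (hg ▸ hG.map _) hp hgρ hind
  have hsec (y : gluedSubalgebra k[X] G P) :
      ((gluingFamily hG hdeg P ρ).sec y).eval s = (Φ y).eval (ρ.eval s) := by
    rw [hΦ, ← eval_eval_eq_eval_map]
    rfl
  let ψ : (gluingFamily hG hdeg P ρ).fibre s →ₐ[k] k[X] :=
    Ideal.Quotient.liftₐ _ Φ fun y hy => (hker y).mp hy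
  have hψ (y : gluedSubalgebra k[X] G P) : ψ (Ideal.Quotient.mk _ y) = Φ y := rfl
  refine ⟨ψ, ?_, ?_, fun y => ⟨fun hy => ?_, fun hy => ?_⟩⟩
  · rw [injective_iff_map_eq_zero]
    intro y hy
    obtain ⟨y, rfl⟩ := Ideal.Quotient.mk_surjective y
    exact Ideal.Quotient.eq_zero_iff_mem.mpr ((hker y).mpr hy)
  · rw [← hrange]
    ext f
    constructor
    · rintro ⟨y, rfl⟩
      obtain ⟨y, rfl⟩ := Ideal.Quotient.mk_surjective y
      exact ⟨y, rfl⟩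
    · rintro ⟨y, rfl⟩
      exact ⟨Ideal.Quotient.mk _ y, rfl⟩
  · have hle : (gluingFamily hG hdeg P ρ).point s ≤
        (Ideal.span {Polynomial.X - Polynomial.C (ρ.eval s)}).comap ψ := by
      rw [Family.point, Ideal.map_le_iff_le_comap]
      intro z hz
      rw [Ideal.mem_comap, Ideal.mem_comap, hψ, Ideal.mem_span_singleton,
        Polynomial.dvd_iff_isRoot, Polynomial.IsRoot, ← hsec]
      exact hz
    have h1 := Ideal.mem_span_singleton.mp (hle hy)
    rw [Polynomial.dvd_iff_isRoot, Polynomial.IsRoot] at h1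
    obtain ⟨y, rfl⟩ := Ideal.Quotient.mk_surjective y
    obtain ⟨α, β, h, e⟩ : Φ y ∈ gluedSubalgebra k g p := hrange ▸ ⟨y, rfl⟩
    rw [hψ, e] at h1 ⊢
    have hα : α = 0 := by simpa [hgρ] using h1
    rw [hα, map_zero, zero_add]
    exact dvd_add (dvd_mul_right _ _) ((dvd_pow_self _ two_ne_zero).mul_right _)
  · obtain ⟨y, rfl⟩ := Ideal.Quotient.mk_surjective y
    refine Ideal.mem_map_of_mem _ ?_
    change ((gluingFamily hG hdeg P ρ).sec y).eval s = 0
    rw [hsec]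
    obtain ⟨z, hz⟩ := hy
    rw [← hψ, hz, Polynomial.eval_mul, hgρ, zero_mul]

/-- A maximal ideal containing every element of the conductor `g^2 k[t]` contains `I`, whose
elements have squares there. As `R = k + I`, it equals `I`. Any other `q` misses a conductor
element. -/
theorem isRegularLocalRing_of_ne_point {R : Type*} [CommRing R] [Algebra k R] {g : k[X]}
    {p : Fin n → k[X]} {ψ : R →ₐ[k] k[X]} (hψ : Function.Injective ψ)
    (hrange : ψ.range = gluedSubalgebra k g p) {I : Ideal R} (hI : ∀ y, y ∈ I ↔ g ∣ ψ y)
    (q : Ideal R) [q.IsMaximal] (hq : q ≠ I) : IsRegularLocalRing (Localization.AtPrime q) := by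
  obtain ⟨u, hu, huq⟩ : ∃ u, g ^ 2 ∣ ψ u ∧ u ∉ q := by
    by_contra! hall
    have hIq : I ≤ q := fun y hy => by
      have := hall (y ^ 2) (by rw [map_pow]; exact pow_dvd_pow_of_dvd ((hI y).mp hy) 2)
      exact (inferInstance : q.IsPrime).mem_of_pow_mem _ this
    refine hq (le_antisymm (fun z hz => ?_) hIq)
    obtain ⟨α, β, h, e⟩ : ψ z ∈ gluedSubalgebra k g p := hrange ▸ ⟨z, rfl⟩
    have h1 : z - algebraMap k R α ∈ I := by
      rw [hI, map_sub, AlgHom.commutes, e]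
      exact ⟨∑ j, β j • p j + g * h, by ring⟩
    have h2 : algebraMap k R α ∈ q := by
      have := q.sub_mem hz (hIq h1)
      rwa [sub_sub_cancel] at this
    have hα : α = 0 := by
      by_contra hne
      exact Ideal.IsPrime.ne_top' (Ideal.eq_top_of_isUnit_mem q h2 ((Ne.isUnit hne).map _))
    rwa [hα, map_zero, sub_zero] at h1
  refine isRegularLocalRing_of_notMem_conductor (ψ := (ψ : R →+* k[X])) hψ q huq fun h => ?_
  obtain ⟨v, hv⟩ := hu
  have : g ^ 2 * (v * h) ∈ ψ.range := hrange ▸ ⟨0, 0, v * h, by simp⟩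
  obtain ⟨r, hr⟩ := this
  exact ⟨r, hr.trans (by rw [← mul_assoc, ← hv]; rfl)⟩

/-- In degree one the rank condition says that the `n` coordinate functions stay independent on the
points, that is, the `a i` span `k^n`. -/
theorem IsUniformPosition.eq_zero_of_sum_eq_zero {r : ℕ} {a : Fin r → Fin n → k}
    (ha : IsUniformPosition a) (hnr : n ≤ r) {β : Fin n → k} (hβ : ∀ i, ∑ j, β j * a i j = 0) :
    β = 0 := by
  have hrank := ha.2.2 Finset.univ 1 le_rfl
  have hspan : LinearMap.range (formEval a Finset.univ 1) = Submodule.span k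
      (Set.range fun j : Fin n => fun i : (Finset.univ : Finset (Fin r)) => a i j) := by
    rw [formEval, LinearMap.range_comp, Submodule.range_subtype,
      MvPolynomial.homogeneousSubmodule_one_eq_span_X, Submodule.map_span, ← Set.range_comp]
    congr 1
    ext v
    simp only [Set.mem_range]
    refine exists_congr fun j => ?_
    have : (fun i : (Finset.univ : Finset (Fin r)) => a i j) =
        (LinearMap.pi fun i : (Finset.univ : Finset (Fin r)) =>
          (MvPolynomial.aeval (R := k) (a i)).toLinearMap) (MvPolynomial.X j) :=
      funext fun i => (MvPolynomial.aeval_X _ _).symm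
    rw [this]
    rfl
  rw [hspan, Finset.card_univ, Fintype.card_fin, Nat.add_sub_cancel, Nat.choose_one_right,
    min_eq_right hnr] at hrank
  have hli := (linearIndependent_iff_card_eq_finrank_span (R := k)
    (b := fun j : Fin n => fun i : (Finset.univ : Finset (Fin r)) => a i j)).mpr
    (by rw [Fintype.card_fin, Set.finrank, hrank])
  rw [Fintype.linearIndependent_iff] at hli
  refine funext fun j => hli β (funext fun i => ?_) j
  rw [Finset.sum_apply]
  exact hβ i

end Family

/-! ### The deformation and its generic tangents. -/

section Deformation

variable {k : Type u} [Field k]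

/-- The polynomial `∏ i, (t - i s)` in `t` over `k[s]`. -/
noncomputable def nodePolynomial (k : Type*) [Field k] (d : ℕ) : k[X][X] :=
  ∏ i : Fin d, (Polynomial.X - Polynomial.C (Polynomial.X * Polynomial.C (i.1 : k)))

theorem nodePolynomial_monic (d : ℕ) : (nodePolynomial k d).Monic :=
  Polynomial.monic_prod_of_monic _ _ fun _ _ => Polynomial.monic_X_sub_C _

theorem natDegree_nodePolynomial (d : ℕ) : (nodePolynomial k d).natDegree = d := by
  rw [nodePolynomial, Polynomial.natDegree_prod_of_monic _ _ fun _ _ => Polynomial.monic_X_sub_C _]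
  simp only [Polynomial.natDegree_X_sub_C, Finset.sum_const, Finset.card_univ, Fintype.card_fin,
    smul_eq_mul, mul_one]

theorem map_nodePolynomial (d : ℕ) (s : k) :
    (nodePolynomial k d).map (Polynomial.evalRingHom s) =
      ∏ i : Fin d, (Polynomial.X - Polynomial.C (s * (i.1 : k))) := by
  simp only [nodePolynomial, Polynomial.map_prod, Polynomial.map_sub, Polynomial.map_X,
    Polynomial.map_C, Polynomial.coe_evalRingHom, Polynomial.eval_mul, Polynomial.eval_X,
    Polynomial.eval_C]

theorem eval_nodePolynomial {d : ℕ} (i : Fin d) :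
    (nodePolynomial k d).eval (Polynomial.X * Polynomial.C (i.1 : k)) = 0 := by
  rw [nodePolynomial, Polynomial.eval_prod]
  exact Finset.prod_eq_zero (Finset.mem_univ i) (by simp)

/-- The polynomial `p + s q` in `t` over `k[s]`. -/
noncomputable def linearDeformation (p q : k[X]) : k[X][X] :=
  p.map Polynomial.C + Polynomial.C Polynomial.X * q.map Polynomial.C

theorem map_linearDeformation (p q : k[X]) (s : k) :
    (linearDeformation p q).map (Polynomial.evalRingHom s) = p + Polynomial.C s * q := by
  have hid : (Polynomial.evalRingHom s).comp Polynomial.C = RingHom.id k :=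
    RingHom.ext fun b => Polynomial.eval_C
  simp only [linearDeformation, Polynomial.map_add, Polynomial.map_mul, Polynomial.map_map, hid,
    Polynomial.map_id, Polynomial.map_C, Polynomial.coe_evalRingHom, Polynomial.eval_X]

/-- The tangent vectors are polynomial in `s`, so a polynomial certificate of uniform position
becomes a polynomial `W` in `s`. It suffices that `W` be nonzero at one value, and `q` is chosen to
arrange this at `s = 1`. -/
theorem exists_deformation_isUniformPosition [CharZero k] {n : ℕ} (d : ℕ) (hn : 1 < n)
    (p : Fin n → k[X]) : ∃ q : Fin n → k[X], ∀ᶠ s : k in Filter.cofinite,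
      IsUniformPosition fun (i : Fin d) j =>
        ((nodePolynomial k d).map (Polynomial.evalRingHom s)).derivative.eval (s * (i.1 : k)) *
          (p j + Polynomial.C s * q j).eval (s * (i.1 : k)) := by
  classical
  obtain ⟨U, hU, hU'⟩ := exists_polynomial_isUniformPosition k d hn
  obtain ⟨a, ha⟩ : ∃ a : Fin d × Fin n → k, MvPolynomial.eval a U ≠ 0 := by
    by_contra! h
    exact hU (MvPolynomial.funext fun x => by rw [h x, map_zero])
  have hinj : Function.Injective fun i : Fin d => (i.1 : k) :=
    Nat.cast_injective.comp Fin.val_injective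
  let g : k[X] := ∏ i : Fin d, (Polynomial.X - Polynomial.C (i.1 : k))
  have hder (i : Fin d) : g.derivative.eval (i.1 : k) ≠ 0 := by
    have hsep : g.Separable := Polynomial.separable_prod_X_sub_C_iff.mpr hinj
    have hroot : Polynomial.aeval (i.1 : k) g = 0 := by
      rw [map_prod]
      exact Finset.prod_eq_zero (Finset.mem_univ i) (by simp)
    simpa using hsep.aeval_derivative_ne_zero hroot
  -- Interpolation solves `g'(i) (p j + q j)(i) = a (i, j)` at the nodes `i`, which are distinct in
  -- characteristic zero.
  let q (j : Fin n) : k[X] := Lagrange.interpolate Finset.univ (fun i : Fin d => (i.1 : k))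
    fun i => a (i, j) / g.derivative.eval (i.1 : k) - (p j).eval (i.1 : k)
  have hq (i : Fin d) (j : Fin n) : (q j).eval (i.1 : k) =
      a (i, j) / g.derivative.eval (i.1 : k) - (p j).eval (i.1 : k) :=
    Lagrange.eval_interpolate_at_node (v := fun i : Fin d => (i.1 : k)) _ hinj.injOn
      (Finset.mem_univ i)
  let Q (x : Fin d × Fin n) : k[X] :=
    (nodePolynomial k d).derivative.eval (Polynomial.X * Polynomial.C (x.1.1 : k)) *
      (linearDeformation (p x.2) (q x.2)).eval (Polynomial.X * Polynomial.C (x.1.1 : k))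
  have hQ (s : k) (x : Fin d × Fin n) : (Q x).eval s =
      ((nodePolynomial k d).map (Polynomial.evalRingHom s)).derivative.eval (s * (x.1.1 : k)) *
        (p x.2 + Polynomial.C s * q x.2).eval (s * (x.1.1 : k)) := by
    rw [Polynomial.eval_mul, eval_eval_eq_eval_map, eval_eval_eq_eval_map, map_linearDeformation,
      Polynomial.derivative_map, Polynomial.eval_mul, Polynomial.eval_X, Polynomial.eval_C]
  let W : k[X] := MvPolynomial.aeval Q U
  have hW (s : k) : W.eval s = MvPolynomial.eval (fun x => (Q x).eval s) U := by
    rw [← Polynomial.coe_aeval_eq_eval, ← AlgHom.comp_apply, MvPolynomial.comp_aeval]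
    rfl
  have hQ1 (x : Fin d × Fin n) : (Q x).eval 1 = a x := by
    have h1 : (nodePolynomial k d).map (Polynomial.evalRingHom 1) = g := by
      rw [map_nodePolynomial]; simp only [one_mul, g]
    rw [hQ, h1, one_mul, Polynomial.C_1, one_mul, Polynomial.eval_add, hq, add_sub_cancel,
      mul_div_cancel₀ _ (hder x.1)]
  have hW0 : W ≠ 0 := by
    intro h0
    apply ha
    have := hW 1
    rw [h0, Polynomial.eval_zero, funext hQ1] at this
    exact this.symm
  refine ⟨q, ?_⟩
  rw [Filter.eventually_cofinite]
  refine (Polynomial.finite_setOfPred_isRoot hW0).subset fun s hs => ?_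
  by_contra hne
  refine hs (hU' _ ?_)
  have := (hW s).symm.trans_ne hne
  simpa only [hQ] using this

theorem IsEquisingularWithC.exists_family [CharZero k] {n d : ℕ} (hn : 1 < n) (hnd : n < d)
    {O : Subalgebra k k⟦X⟧} (hO : IsEquisingularWithC n d O) :
    ∃ F : Family k, Nonempty (F.germ 0 ≃ₐ[k] O) ∧ ∀ᶠ c : k in Filter.cofinite,
      (∃ a : Fin d → Fin n → k, IsUniformPosition a ∧ Nonempty (F.germ c ≃ₐ[k] branchAlgebra a)) ∧
        F.SmoothOffSection c := by
  obtain ⟨p, rfl, hp⟩ := hO.exists_eq_gluedSubalgebra hnd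
  obtain ⟨q, hq⟩ := exists_deformation_isUniformPosition d hn p
  have hd : (nodePolynomial k d).natDegree ≠ 0 := by rw [natDegree_nodePolynomial]; omega
  let i₀ : Fin d := ⟨0, by omega⟩
  refine ⟨gluingFamily (nodePolynomial_monic d) hd (fun j => linearDeformation (p j) (q j))
    (Polynomial.X * Polynomial.C (i₀.1 : k)), ?_, ?_⟩
  · obtain ⟨ψ, hψ, hrange, hpt⟩ := exists_fibre_hom (nodePolynomial_monic d) hd
      (fun j => linearDeformation (p j) (q j)) (eval_nodePolynomial i₀) (s := (0 : k))
      (g := Polynomial.X ^ d) (p := p) (by rw [map_nodePolynomial]; simp)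
      (fun j => by rw [map_linearDeformation]; simp) hp
    exact nonempty_adicCompletion_equiv_of_X_pow (by omega) hψ hrange (fun y hy => (hpt y).mp hy)
      fun y hy => (hpt y).mpr ((dvd_pow_self _ two_ne_zero).trans hy)
  · filter_upwards [hq, Filter.eventually_cofinite_ne (0 : k)] with s hs hs0
    have hinj : Function.Injective fun i : Fin d => s * (i.1 : k) :=
      (mul_right_injective₀ hs0).comp (Nat.cast_injective.comp Fin.val_injective)
    obtain ⟨ψ, hψ, hrange, hpt⟩ := exists_fibre_hom (nodePolynomial_monic d) hd
      (fun j => linearDeformation (p j) (q j)) (eval_nodePolynomial i₀) (s := s) rfl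
      (p := fun j => p j + Polynomial.C s * q j) (fun j => map_linearDeformation _ _ _)
      fun β hβ => by
        -- A combination divisible by `g` vanishes at every node, so `β` annihilates all the tangent
        -- vectors, and these span because `n ≤ d`.
        refine hs.eq_zero_of_sum_eq_zero hnd.le fun i => ?_
        have hroot : ((nodePolynomial k d).map (Polynomial.evalRingHom s)).eval (s * (i.1 : k))
            = 0 := by
          have := eval_eval_eq_eval_map s (Polynomial.X * Polynomial.C (i.1 : k))
            (nodePolynomial k d)
          rwa [eval_nodePolynomial, Polynomial.eval_zero, Polynomial.eval_mul, Polynomial.eval_X,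
            Polynomial.eval_C, eq_comm] at this
        have := Polynomial.eval_dvd (x := s * (i.1 : k)) hβ
        rw [hroot, zero_dvd_iff, Polynomial.eval_finsetSum] at this
        simp only [Polynomial.eval_smul, smul_eq_mul] at this
        refine (Finset.sum_congr rfl fun j _ => mul_left_comm _ _ _).trans ?_
        rw [← Finset.mul_sum]
        exact (congrArg _ this).trans (mul_zero _)
    exact ⟨⟨_, hs, nonempty_adicCompletion_equiv_of_prod hinj (map_nodePolynomial d s) hψ hrange
      (fun y hy => (hpt y).mp hy)
      fun y hy => (hpt y).mpr ((dvd_pow_self _ two_ne_zero).trans hy)⟩,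
      fun q' _ hq' => isRegularLocalRing_of_ne_point hψ hrange hpt q' hq'⟩

end Deformation

end CurveSing

theorem mainTheorem12 {k : Type u} [Field k] [IsAlgClosed k] [CharZero k]
    (n d : ℕ) (hn : 1 < n) (hnd : n < d)
    (O : Subalgebra k (PowerSeries k)) (hO : CurveSing.IsEquisingularWithC n d O) :
    CurveSing.DeformsInto (k := k) O
        (fun R _ _ => CurveSing.IsSingularWithSmoothBranches k R) ∧
    (d ≤ 2 * n - 1 →
      CurveSing.DeformsInto (k := k) O (fun R _ _ => CurveSing.IsL (k := k) d n R)) ∧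
    (2 * n ≤ d →
      CurveSing.DeformsInto (k := k) O
        (fun R _ _ =>
          CurveSing.IsS (k := k) d n (max n (n + d - (n + 1).choose 2)) R)) := by
  obtain ⟨F, h₀, hF⟩ := hO.exists_family hn hnd
  refine ⟨⟨F, h₀, hF.mono ?_⟩, fun hd => ⟨F, h₀, hF.mono ?_⟩, fun _ => ⟨F, h₀, hF.mono ?_⟩⟩
  · rintro c ⟨⟨a, ha, ⟨e⟩⟩, hs⟩
    exact ⟨CurveSing.isSingularWithSmoothBranches_of_equiv ha.1 (by omega) e, hs⟩
  · rintro c ⟨⟨a, ha, ⟨e⟩⟩, hs⟩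
    refine ⟨CurveSing.isL_of_equiv ha ?_ e, hs⟩
    obtain ⟨m, rfl⟩ : ∃ m, n = m + 2 := ⟨n - 2, by omega⟩
    -- For `n = m + 2` the difference of the two sides is `(n - 1)(n - 2) / 2`.
    have h : 2 * (m + 2) - 1 ≤ (m + 2 + 1).choose 2 := by
      rw [Nat.choose_two_right, Nat.le_div_iff_mul_le two_pos]
      simp only [Nat.add_sub_cancel]
      have : 2 * (m + 2) - 1 = 2 * m + 3 := by omega
      rw [this]
      nlinarith
    exact hd.trans h
  · rintro c ⟨⟨a, ha, ⟨e⟩⟩, hs⟩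
    exact ⟨CurveSing.isS_of_equiv ha e, hs⟩
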